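/- Let $\mathbb S^2\subset\mathbb R^3$ be the unit sphere with its round metric, surface measure, Laplace–Beltrami operator $\Delta_{\mathbb S^2}$ and geodesic distance $d$; let $\mathbf n=(0,0,1)$, $\mathbf s=(0,0,-1)$, and write $\theta_3$ for the last coordinate of $\theta\in\mathbb S^2$. Let $K,f:\mathbb S^2\setminus\{\mathbf n,\mathbf s\}\to[0,\infty)$ be continuous and rotationally symmetric about the line through $\mathbf n$ and $\mathbf s$. Assume: (K1) for all $\theta,\theta'\in\mathbb S^2\setminus\{\mathbf n,\mathbf s\}$ on the same geodesic through $\mathbf n$ and $\mathbf s$, $K(\theta)\ge K(\theta')$ if $\theta_3>\theta_3'\ge 0$, and $K(\theta)\ge K(\theta')$ if $\theta_3<\theta_3'\le 0$; (f1) for all $\theta,\theta'\in\mathbb S^2\setminus\{\mathbf n,\mathbf s\}$ on the same geodesic through $\mathbf n$ and $\mathbf s$, $f(\theta)\ge f(\theta')$ if $\theta_3>\theta_3'\ge 0$, and $f(\theta)\ge f(\theta')$ if $\theta_3<\theta_3'\le 0$; (Kf1) the function $f^2+(K-\bar K)^2$ is not identically zero on $\mathbb S^2\setminus\{\mathbf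 n,\mathbf s\}$, where $\bar K=\frac1{4\pi}\int_{\mathbb S^2}K$ is the mean of $K$ (if $K$ is not integrable, this condition is regarded as satisfied). Then every solution $v\in C^2(\mathbb S^2\setminus\{\mathbf n,\mathbf s\})$ of $$-\Delta_{\mathbb S^2}v+1=K(\theta)e^{2v}+f(\theta)\quad\text{on }\mathbb S^2\setminus\{\mathbf n,\mathbf s\}$$ satisfying $$\limsup_{\theta\to\mathbf n}\frac{v(\theta)}{\log d(\theta,\mathbf n)}\le 0\quad\text{and}\quad\limsup_{\theta\to\mathbf s}\frac{v(\theta)}{\log d(\theta,\mathbf s)}\le 0$$ is rotationally symmetric about the line through $\mathbf n$ and $\mathbf s$. -/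

import Mathlib

open Filter Topology MeasureTheory
open scoped Manifold

noncomputable section

namespace SphereEq

/-- Euclidean three-space. -/
abbrev E3 : Type := EuclideanSpace ℝ (Fin 3)

/-- The unit sphere `S²` in `ℝ³`. -/
abbrev S2 : Type := Metric.sphere (0 : E3) 1

/-- Mathlib's manifold structure on the sphere (with model `𝓡 2`) reads the dimension off this. -/
instance factFinrankE3 : Fact (Module.finrank ℝ E3 = 2 + 1) := ⟨by simp⟩

/-- The north pole `(0, 0, 1)`. -/
def north : S2 := ⟨EuclideanSpace.single 2 1, by simp⟩

/-- The south pole `(0, 0, -1)`. -/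
def south : S2 := -north

/-- The doubly punctured sphere `S² \ {n, s}`. -/
def puncturedSphere : Set S2 := {north, south}ᶜ

/-- The height `θ₃`, the last coordinate of a point of the sphere. -/
def height (θ : S2) : ℝ := (θ : E3) 2

/-- The geodesic distance on the unit sphere: the angle between two unit vectors. -/
def geodDist (θ θ' : S2) : ℝ := InnerProductGeometry.angle (θ : E3) (θ' : E3)

/-- The surface measure on `S²` induced by Lebesgue measure on `ℝ³`. -/
def surfaceMeasure : Measure S2 := (volume : Measure E3).toSphere

/-- The radial projection `x ↦ x / |x|` of `ℝ³ \ {0}` onto the sphere. -/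
def radialProj (x : E3) (hx : x ≠ 0) : S2 :=
  ⟨‖x‖⁻¹ • x, by simp [norm_smul, hx]⟩

open Classical in
/-- The extension of a function on the sphere to `ℝ³ \ {0}` that is homogeneous of degree zero,
`x ↦ v (x / |x|)` (with the irrelevant value `0` at the origin). -/
def homogExt (v : S2 → ℝ) (x : E3) : ℝ :=
  if hx : x ≠ 0 then v (radialProj x hx) else 0

/-- The Laplace-Beltrami operator of the round sphere: the Euclidean Laplacian, at points of the
sphere, of the extension that is homogeneous of degree zero. Its value at `θ` depends only on `v`
near `θ`. -/
def sphereLaplacian (v : S2 → ℝ) (θ : S2) : ℝ :=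
  Laplacian.laplacian (homogExt v) (θ : E3)

/-- `v` is rotationally symmetric, on the punctured sphere, about the line through the poles:
it is invariant under all orthogonal transformations of `ℝ³` that fix the north pole. The orbits are the circles of latitude, the same
as those of the rotations about the axis. -/
def RotSymm (v : S2 → ℝ) : Prop :=
  ∀ R : E3 ≃ₗᵢ[ℝ] E3, R (north : E3) = (north : E3) →
    ∀ θ ∈ puncturedSphere, ∀ θ' : S2, (θ' : E3) = R (θ : E3) → v θ' = v θ

/-- The geodesic (great circle) through the poles that leaves the north pole in the direction of
the unit vector `u` orthogonal to it. -/
def polarGeodesic (u : E3) : Set S2 :=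
  {θ | ∃ t : ℝ, (θ : E3) = Real.cos t • (north : E3) + Real.sin t • u}

/-- `θ` and `θ'` lie on the same geodesic passing through both poles. -/
def OnSamePolarGeodesic (θ θ' : S2) : Prop :=
  ∃ u : E3, ‖u‖ = 1 ∧ inner ℝ u (north : E3) = 0 ∧ θ ∈ polarGeodesic u ∧ θ' ∈ polarGeodesic u

/-- Along every geodesic through the poles, the function does not decrease when one moves away
from the equator within the closed northern or the closed southern hemisphere. -/
def MonotoneTowardsPoles (h : S2 → ℝ) : Prop :=
  ∀ θ ∈ puncturedSphere, ∀ θ' ∈ puncturedSphere, OnSamePolarGeodesic θ θ' →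
    (height θ > height θ' → height θ' ≥ 0 → h θ ≥ h θ') ∧
    (height θ < height θ' → height θ' ≤ 0 → h θ ≥ h θ')

end SphereEq

end

/-! The proof is the method of moving planes, run on a cylinder whose axis is horizontal. For a unit
vector `e` orthogonal to the north pole, the conformal parametrization `cylinderMap` uses the axis
`e`, so that reflecting the sphere in the plane orthogonal to `e` becomes `t ↦ -t`, and both poles
lie on the circle `t = 0`, at `φ ∈ πℤ`. Since the flat Laplacian is `cosh⁻² t` times that of the
sphere, `w = v - log cosh t` solves `-Δw = K e^{2w} + f / cosh² t`. Along each line `φ = const`, the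
modulus of the height is `|cos φ| / cosh t`; hence (K1), (f1) and symmetry make both data grow as
`|t|` decreases.

For `τ < 0` compare `w` with its reflection in `t = τ`. Convexity of the exponential and
monotonicity of the data give `Δz ≤ -c z` for the difference `z`, with `c = 2K e^{2w} ≥ 0`, off the
reflected poles on `t = 2τ`. The aim is `z ≥ 0` for every `τ < 0`. Far to the left this follows from
the decay of `w` together with a minimum principle on strips that are narrow relative to `c`
(`exists_start`). If it holds at `τ`, nondegeneracy and the strong minimum principle make `z`
positive, a Phragmén–Lindelöf argument makes it bounded below away from the plane, and the plane can
move on (`exists_continue`). In the limit `τ → 0`, `w t φ ≤ w (-t) φ` for `t < 0` (`le_reflection`).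

The singularities are controlled by the harmonic function `log (sinh² t + sin² φ)`. The limsup
hypotheses say that `v` lies above every positive multiple of this logarithm near the poles, so
subtracting a small multiple of it makes the poles invisible to the minimum principle
(`le_of_superharmonic_of_log_le`). No upper bound for `v` at the poles is needed.

Condition (Kf1) enters only to exclude `z ≡ 0` for some `τ < 0`: equality would force `f = 0` and
make `K` invariant under a contraction of heights, hence constant by continuity at the equator.
Finally, two distinct non-antipodal points of equal height are exchanged by a reflection of the
above kind; using both orders of the pair gives equality of `v`, and antipodal points are joined
through a third point of the equator. -/

noncomputable section

namespace SphereEq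

/-! ### Pure second derivatives and the planar Laplacian -/

/-- `g` is differentiable near `t` and its derivative has derivative `A` at `t`. -/
def HasSecondDerivAt (g : ℝ → ℝ) (A t : ℝ) : Prop :=
  ∃ g' : ℝ → ℝ, (∀ᶠ s in 𝓝 t, HasDerivAt g (g' s) s) ∧ HasDerivAt g' A t

/-- The two pure second partial derivatives of `u` at `(t, φ)` exist, and their sum is `L`. -/
def HasLaplacianAt (u : ℝ → ℝ → ℝ) (t φ L : ℝ) : Prop :=
  ∃ A B : ℝ, HasSecondDerivAt (fun s => u s φ) A t ∧ HasSecondDerivAt (fun s => u t s) B φ ∧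
    A + B = L

theorem HasSecondDerivAt.add {g h : ℝ → ℝ} {A B t : ℝ} (hg : HasSecondDerivAt g A t)
    (hh : HasSecondDerivAt h B t) : HasSecondDerivAt (fun s => g s + h s) (A + B) t := by
  obtain ⟨g', hg1, hg2⟩ := hg
  obtain ⟨h', hh1, hh2⟩ := hh
  refine ⟨fun s => g' s + h' s, ?_, hg2.add hh2⟩
  filter_upwards [hg1, hh1] with s h1 h2 using h1.add h2

theorem HasSecondDerivAt.const_mul {g : ℝ → ℝ} {A t : ℝ} (c : ℝ) (hg : HasSecondDerivAt g A t) :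
    HasSecondDerivAt (fun s => c * g s) (c * A) t := by
  obtain ⟨g', hg1, hg2⟩ := hg
  refine ⟨fun s => c * g' s, ?_, hg2.const_mul c⟩
  filter_upwards [hg1] with s h1 using h1.const_mul c

theorem hasSecondDerivAt_const (c t : ℝ) : HasSecondDerivAt (fun _ => c) 0 t :=
  ⟨fun _ => 0, Eventually.of_forall fun s => hasDerivAt_const s c, hasDerivAt_const t 0⟩

theorem HasSecondDerivAt.comp_const_sub {g : ℝ → ℝ} {A t : ℝ} (c : ℝ)
    (hg : HasSecondDerivAt g A (c - t)) : HasSecondDerivAt (fun s => g (c - s)) A t := by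
  obtain ⟨g', hg1, hg2⟩ := hg
  refine ⟨fun s => - g' (c - s), ?_, ?_⟩
  · have hc : Tendsto (fun s => c - s) (𝓝 t) (𝓝 (c - t)) := (continuous_const.sub continuous_id).tendsto t
    filter_upwards [hc.eventually hg1] with s hs
    exact hs.comp_const_sub c s
  · exact (hg2.comp_const_sub c t).neg.congr_deriv (by simp)

theorem HasSecondDerivAt.congr_eventuallyEq {g h : ℝ → ℝ} {A t : ℝ}
    (hg : HasSecondDerivAt g A t) (e : h =ᶠ[𝓝 t] g) : HasSecondDerivAt h A t := by
  obtain ⟨g', hg1, hg2⟩ := hg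
  refine ⟨g', ?_, hg2⟩
  filter_upwards [hg1, e.eventuallyEq_nhds] with s h1 h2 using h1.congr_of_eventuallyEq h2

/-- If `A < 0`, the second derivative test makes `t` a local maximum as well, so `g` is locally
constant and `A = 0`. -/
theorem HasSecondDerivAt.nonneg_of_isLocalMin {g : ℝ → ℝ} {A t : ℝ}
    (hg : HasSecondDerivAt g A t) (hm : IsLocalMin g t) : 0 ≤ A := by
  by_contra! hA
  obtain ⟨g', hg1, hg2⟩ := hg
  have hev : deriv g =ᶠ[𝓝 t] g' := by
    filter_upwards [hg1] with s hs using hs.deriv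
  have hdd : deriv (deriv g) t = A := by rw [hev.deriv_eq, hg2.deriv]
  have hmax := isLocalMax_of_deriv_deriv_neg (by rw [hdd]; exact hA) hm.deriv_eq_zero
    hg1.self_of_nhds.continuousAt
  have hconst : g =ᶠ[𝓝 t] fun _ => g t := by
    filter_upwards [hm, hmax] with s h1 h2 using le_antisymm h2 h1
  have h0 : deriv g =ᶠ[𝓝 t] fun _ => (0 : ℝ) := by
    filter_upwards [hconst.eventuallyEq_nhds] with s hs
    rw [hs.deriv_eq]; simp
  have : deriv (deriv g) t = 0 := by rw [h0.deriv_eq]; simp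
  linarith

theorem HasLaplacianAt.add {u v : ℝ → ℝ → ℝ} {t φ L M : ℝ} (hu : HasLaplacianAt u t φ L)
    (hv : HasLaplacianAt v t φ M) : HasLaplacianAt (fun t φ => u t φ + v t φ) t φ (L + M) := by
  obtain ⟨A, B, hA, hB, rfl⟩ := hu
  obtain ⟨A', B', hA', hB', rfl⟩ := hv
  exact ⟨_, _, hA.add hA', hB.add hB', by ring⟩

theorem HasLaplacianAt.const_mul {u : ℝ → ℝ → ℝ} {t φ L : ℝ} (c : ℝ)
    (hu : HasLaplacianAt u t φ L) : HasLaplacianAt (fun t φ => c * u t φ) t φ (c * L) := by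
  obtain ⟨A, B, hA, hB, rfl⟩ := hu
  exact ⟨_, _, hA.const_mul c, hB.const_mul c, by ring⟩

theorem HasLaplacianAt.sub {u v : ℝ → ℝ → ℝ} {t φ L M : ℝ} (hu : HasLaplacianAt u t φ L)
    (hv : HasLaplacianAt v t φ M) : HasLaplacianAt (fun t φ => u t φ - v t φ) t φ (L - M) := by
  simpa [sub_eq_add_neg] using hu.add (hv.const_mul (-1))

theorem HasSecondDerivAt.hasLaplacianAt_fst {g : ℝ → ℝ} {A t : ℝ} (hg : HasSecondDerivAt g A t)
    (φ : ℝ) : HasLaplacianAt (fun s _ => g s) t φ A :=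
  ⟨A, 0, hg, hasSecondDerivAt_const _ _, by simp⟩

theorem HasLaplacianAt.comp_const_sub {u : ℝ → ℝ → ℝ} {t φ L : ℝ} (c : ℝ)
    (hu : HasLaplacianAt u (c - t) φ L) : HasLaplacianAt (fun t φ => u (c - t) φ) t φ L := by
  obtain ⟨A, B, hA, hB, h⟩ := hu
  exact ⟨A, B, hA.comp_const_sub c, hB, h⟩

theorem HasLaplacianAt.nonneg_of_isLocalMin {u : ℝ → ℝ → ℝ} {t φ L : ℝ}
    (hu : HasLaplacianAt u t φ L) (hm : ∀ᶠ p in 𝓝 (t, φ), u t φ ≤ u p.1 p.2) : 0 ≤ L := by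
  obtain ⟨A, B, hA, hB, rfl⟩ := hu
  have h1 : Tendsto (fun s : ℝ => (s, φ)) (𝓝 t) (𝓝 (t, φ)) :=
    (by fun_prop : Continuous fun s : ℝ => (s, φ)).tendsto t
  have h2 : Tendsto (fun s : ℝ => (t, s)) (𝓝 φ) (𝓝 (t, φ)) :=
    (by fun_prop : Continuous fun s : ℝ => (t, s)).tendsto φ
  exact add_nonneg (hA.nonneg_of_isLocalMin (h1.eventually hm))
    (hB.nonneg_of_isLocalMin (h2.eventually hm))

/-- The Laplacian is nonnegative at an interior minimum over a set. -/
theorem HasLaplacianAt.nonneg_of_isMinOn {u : ℝ → ℝ → ℝ} {p : ℝ × ℝ} {L : ℝ} {Q U : Set (ℝ × ℝ)}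
    (hu : HasLaplacianAt u p.1 p.2 L) (hm : IsMinOn (fun q : ℝ × ℝ => u q.1 q.2) Q p)
    (hU : IsOpen U) (hpU : p ∈ U) (hUQ : U ⊆ Q) : 0 ≤ L := by
  refine hu.nonneg_of_isLocalMin ?_
  filter_upwards [hU.mem_nhds hpU] with q hq using hm (hUQ hq)

/-! ### Periodic functions on strips -/

/-- A function that is continuous on a nonempty closed subset of a strip, both periodic in the
second variable, attains its minimum. -/
theorem exists_isMinOn_of_periodic {h : ℝ → ℝ → ℝ} {Q : Set (ℝ × ℝ)} {a b c : ℝ} (hc : 0 < c)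
    (hper : ∀ t φ, h t (φ + c) = h t φ) (hQper : ∀ t φ, (t, φ + c) ∈ Q ↔ (t, φ) ∈ Q)
    (hQ : IsClosed Q) (hQab : ∀ p ∈ Q, p.1 ∈ Set.Icc a b) (hne : Q.Nonempty)
    (hcont : ContinuousOn (fun p : ℝ × ℝ => h p.1 p.2) Q) :
    ∃ p ∈ Q, IsMinOn (fun p : ℝ × ℝ => h p.1 p.2) Q p := by
  -- Translation into one period reduces the minimum to a compact rectangle.
  have hshift : ∀ p ∈ Q, ∃ ψ ∈ Set.Icc 0 c, (p.1, ψ) ∈ Q ∧ h p.1 ψ = h p.1 p.2 := by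
    rintro ⟨t, φ⟩ hp
    have hP : Function.Periodic (fun φ => ((t, φ) ∈ Q, h t φ)) c := by
      intro φ
      simp only [hper, hQper]
    obtain ⟨ψ, hψ, e⟩ := hP.exists_mem_Ico₀ hc φ
    simp only [Prod.mk.injEq, eq_iff_iff] at e
    exact ⟨ψ, ⟨hψ.1, hψ.2.le⟩, e.1.1 hp, e.2.symm⟩
  have hcomp : IsCompact (Q ∩ Set.Icc a b ×ˢ Set.Icc 0 c) :=
    (isCompact_Icc.prod isCompact_Icc).inter_left hQ
  obtain ⟨p₀, hp₀⟩ := hne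
  obtain ⟨ψ, hψ, hψQ, -⟩ := hshift p₀ hp₀
  obtain ⟨p, hp, hmin⟩ := hcomp.exists_isMinOn ⟨(p₀.1, ψ), hψQ, hQab _ hψQ, hψ⟩
    (hcont.mono Set.inter_subset_left)
  refine ⟨p, hp.1, fun q hq => ?_⟩
  obtain ⟨χ, hχ, hχQ, e⟩ := hshift q hq
  have := hmin (show (q.1, χ) ∈ _ from ⟨hχQ, hQab _ hχQ, hχ⟩)
  simpa [e] using this

theorem hasSecondDerivAt_quadratic (α β a t : ℝ) :
    HasSecondDerivAt (fun s => α + β * (s - a) ^ 2) (2 * β) t := by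
  refine ⟨fun s => 2 * β * (s - a), Eventually.of_forall fun s => ?_, ?_⟩
  · have := ((((hasDerivAt_id s).sub_const a).pow 2).const_mul β).const_add α
    exact this.congr_deriv (by simp; ring)
  · have := ((hasDerivAt_id t).sub_const a).const_mul (2 * β)
    exact this.congr_deriv (by simp)

/-- Minimum principle on narrow strips. -/
theorem nonneg_of_narrow_strip {z c : ℝ → ℝ → ℝ} {a b C T : ℝ} (hT : 0 < T)
    (hper : ∀ t φ, z t (φ + T) = z t φ)
    (hcont : ContinuousOn (fun p : ℝ × ℝ => z p.1 p.2) (Set.Icc a b ×ˢ Set.univ))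
    (hC : 0 < C) (hnarrow : C * (b - a) ^ 2 ≤ 1)
    (ha : ∀ φ, 0 ≤ z a φ) (hb : ∀ φ, 0 ≤ z b φ)
    (hc : ∀ t ∈ Set.Ioo a b, ∀ φ, 0 ≤ c t φ ∧ c t φ ≤ C)
    (hlap : ∀ t ∈ Set.Ioo a b, ∀ φ, ∃ L, HasLaplacianAt z t φ L ∧ L ≤ -(c t φ * z t φ)) :
    ∀ t ∈ Set.Icc a b, ∀ φ, 0 ≤ z t φ := by
  intro t ht φ
  by_contra! hneg
  -- Narrowness gives `1 ≤ ψ`, while `ψ < 2` inside and `ψ'' = -2C`. At a negative minimum `k` of `z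
  -- / ψ`, the function `z - kψ` has a minimum, so `L ≥ 2C|k|`; but `L ≤ -c z ≤ C|k|ψ < 2C|k|`.
  set ψ : ℝ → ℝ := fun t => 2 + (-C) * (t - a) ^ 2 with hψ
  have hψ1 : ∀ t ∈ Set.Icc a b, 1 ≤ ψ t := by
    intro t ht
    have : (t - a) ^ 2 ≤ (b - a) ^ 2 := by
      have := ht.1; have := ht.2
      exact pow_le_pow_left₀ (by linarith) (by linarith) 2
    have := mul_le_mul_of_nonneg_left this hC.le
    simp only [hψ]; linarith
  obtain ⟨p, hp, hmin⟩ := exists_isMinOn_of_periodic (h := fun t φ => z t φ / ψ t)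
    (Q := Set.Icc a b ×ˢ Set.univ) (a := a) (b := b) hT (fun t φ => by simp [hper])
    (fun t φ => by simp) (isClosed_Icc.prod isClosed_univ) (fun p hp => hp.1)
    ⟨(t, φ), ht, trivial⟩
    (hcont.div (by fun_prop) (fun p hp => by have := hψ1 _ hp.1; positivity))
  set k := z p.1 p.2 / ψ p.1 with hk
  have hψp := hψ1 _ hp.1
  have hk0 : k < 0 := by
    have h1 : k ≤ z t φ / ψ t := hmin (show (t, φ) ∈ _ from ⟨ht, trivial⟩)
    have h2 : z t φ / ψ t < 0 := div_neg_of_neg_of_pos hneg (by linarith [hψ1 t ht])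
    linarith
  have hzp : z p.1 p.2 = k * ψ p.1 := by rw [hk]; field_simp
  have hzneg : z p.1 p.2 < 0 := by rw [hzp]; exact mul_neg_of_neg_of_pos hk0 (by linarith)
  have hpI : p.1 ∈ Set.Ioo a b := by
    refine ⟨lt_of_le_of_ne hp.1.1 ?_, lt_of_le_of_ne hp.1.2 ?_⟩
    · intro e; rw [← e] at hzneg; linarith [ha p.2]
    · intro e; rw [e] at hzneg; linarith [hb p.2]
  obtain ⟨L, hL, hLle⟩ := hlap _ hpI p.2
  have hL' := hL.sub (((hasSecondDerivAt_quadratic 2 (-C) a p.1).hasLaplacianAt_fst p.2).const_mul k)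
  have h0 : 0 ≤ L - k * (2 * -C) := by
    refine hL'.nonneg_of_isMinOn (Q := Set.Icc a b ×ˢ Set.univ) ?_ (isOpen_Ioo.prod isOpen_univ)
      ⟨hpI, trivial⟩ (Set.prod_mono Set.Ioo_subset_Icc_self le_rfl)
    intro q hq
    have h1 : k ≤ z q.1 q.2 / ψ q.1 := hmin hq
    have h2 := hψ1 _ hq.1
    rw [le_div_iff₀ (by linarith)] at h1
    change z p.1 p.2 - k * ψ p.1 ≤ z q.1 q.2 - k * ψ q.1
    linarith
  obtain ⟨hc0, hcC⟩ := hc _ hpI p.2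
  have hψ2 : ψ p.1 < 2 := by
    have : 0 < (p.1 - a) ^ 2 := by have := hpI.1; exact pow_pos (by linarith) 2
    simp only [hψ]; nlinarith
  have h3 : -(c p.1 p.2 * z p.1 p.2) ≤ C * (-z p.1 p.2) := by nlinarith
  rw [hzp] at h3 hLle
  have : C * (-(k * ψ p.1)) < 2 * C * (-k) := by
    have : ψ p.1 * (C * -k) < 2 * (C * -k) :=
      mul_lt_mul_of_pos_right hψ2 (mul_pos hC (by linarith))
    linarith
  linarith

/-! ### The singular barrier -/

/-- The function `sinh² t + sin² φ`, which vanishes exactly at the points `(0, kπ)`. -/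
def poleFun (t φ : ℝ) : ℝ := Real.sinh t ^ 2 + Real.sin φ ^ 2

theorem poleFun_nonneg (t φ : ℝ) : 0 ≤ poleFun t φ := by unfold poleFun; positivity

theorem poleFun_add_two_pi (t φ : ℝ) : poleFun t (φ + 2 * Real.pi) = poleFun t φ := by
  simp [poleFun]

theorem continuous_poleFun : Continuous fun p : ℝ × ℝ => poleFun p.1 p.2 := by
  unfold poleFun; fun_prop

theorem poleFun_ne_zero_of_ne {t : ℝ} (ht : t ≠ 0) (φ : ℝ) : poleFun t φ ≠ 0 := by
  unfold poleFun
  have : Real.sinh t ≠ 0 := by simpa using ht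
  positivity

theorem poleFun_pos {t φ : ℝ} (h : poleFun t φ ≠ 0) : 0 < poleFun t φ :=
  lt_of_le_of_ne (poleFun_nonneg _ _) (Ne.symm h)

/-- `poleFun t φ` equals `|sinh (t + iφ)|²`, so its logarithm is twice the log-modulus of a
holomorphic function. -/
theorem hasLaplacianAt_log_poleFun {t₀ t φ : ℝ} (h : poleFun (t - t₀) φ ≠ 0) :
    HasLaplacianAt (fun t φ => Real.log (poleFun (t - t₀) φ)) t φ 0 := by
  have hpos := poleFun_pos h
  have d1 : ∀ s, HasDerivAt (fun s => poleFun (s - t₀) φ)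
      (2 * Real.sinh (s - t₀) * Real.cosh (s - t₀)) s := by
    intro s
    have := ((((hasDerivAt_id s).sub_const t₀).sinh).pow 2).add_const (Real.sin φ ^ 2)
    exact this.congr_deriv (by simp)
  have d2 : ∀ s, HasDerivAt (fun s => poleFun (t - t₀) s) (2 * Real.sin s * Real.cos s) s := by
    intro s
    have := ((Real.hasDerivAt_sin s).pow 2).const_add (Real.sinh (t - t₀) ^ 2)
    exact this.congr_deriv (by simp)
  have c1 : Continuous fun s => poleFun (s - t₀) φ := by unfold poleFun; fun_prop
  have c2 : Continuous fun s => poleFun (t - t₀) s := by unfold poleFun; fun_prop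
  refine ⟨(2 * (Real.cosh (t - t₀) * Real.cosh (t - t₀) + Real.sinh (t - t₀) * Real.sinh (t - t₀))
      * poleFun (t - t₀) φ - 2 * Real.sinh (t - t₀) * Real.cosh (t - t₀)
      * (2 * Real.sinh (t - t₀) * Real.cosh (t - t₀))) / poleFun (t - t₀) φ ^ 2,
    (2 * (Real.cos φ * Real.cos φ - Real.sin φ * Real.sin φ)
      * poleFun (t - t₀) φ - 2 * Real.sin φ * Real.cos φ
      * (2 * Real.sin φ * Real.cos φ)) / poleFun (t - t₀) φ ^ 2,
    ⟨fun s => 2 * Real.sinh (s - t₀) * Real.cosh (s - t₀) / poleFun (s - t₀) φ, ?_, ?_⟩,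
    ⟨fun s => 2 * Real.sin s * Real.cos s / poleFun (t - t₀) s, ?_, ?_⟩, ?_⟩
  · filter_upwards [c1.continuousAt.eventually_ne h] with s hs using (d1 s).log hs
  · have hs := ((hasDerivAt_id t).sub_const t₀).sinh
    have hc := ((hasDerivAt_id t).sub_const t₀).cosh
    exact (((hs.const_mul 2).mul hc).div (d1 t) h).congr_deriv (by simp; ring)
  · filter_upwards [c2.continuousAt.eventually_ne h] with s hs using (d2 s).log hs
  · exact ((((Real.hasDerivAt_sin φ).const_mul 2).mul (Real.hasDerivAt_cos φ)).div
      (d2 φ) h).congr_deriv (by simp only [Pi.mul_apply]; ring)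
  · rw [← add_div, div_eq_zero_iff]
    left
    have e1 := Real.cosh_sq (t - t₀)
    have e2 := Real.cos_sq' φ
    unfold poleFun
    linear_combination (2 * Real.sin φ ^ 2 - 2 * Real.sinh (t - t₀) ^ 2) * e1 +
      (2 * Real.sinh (t - t₀) ^ 2 - 2 * Real.sin φ ^ 2) * e2

/-! ### Minimum principles with singular points -/

theorem poleFun_le_cosh_sq {t r : ℝ} (h : |t| ≤ r) (φ : ℝ) : poleFun t φ ≤ Real.cosh r ^ 2 := by
  have h1 : Real.cosh t ≤ Real.cosh r := Real.cosh_le_cosh.2 (h.trans (le_abs_self r))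
  have h2 : Real.cosh t ^ 2 ≤ Real.cosh r ^ 2 :=
    pow_le_pow_left₀ (Real.cosh_pos t).le h1 2
  have h3 := Real.cosh_sq t
  have h4 := Real.sin_sq_le_one φ
  unfold poleFun; linarith

/-- A superharmonic function on a strip with singularities at the poles, at which it is bounded
below by every positive multiple of the logarithm, satisfies the minimum principle. -/
theorem le_of_superharmonic_of_log_le {z : ℝ → ℝ → ℝ} {a b t₀ m : ℝ} (ht₀ : t₀ ∈ Set.Ioo a b)
    (hper : ∀ t φ, z t (φ + 2 * Real.pi) = z t φ)
    (hcont : ContinuousOn (fun p : ℝ × ℝ => z p.1 p.2)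
      {p | p.1 ∈ Set.Icc a b ∧ poleFun (p.1 - t₀) p.2 ≠ 0})
    (ha : ∀ φ, m ≤ z a φ) (hb : ∀ φ, m ≤ z b φ)
    (hlap : ∀ t ∈ Set.Ioo a b, ∀ φ, poleFun (t - t₀) φ ≠ 0 → ∃ L, HasLaplacianAt z t φ L ∧ L ≤ 0)
    (hsing : ∀ η > 0, ∃ ρ > 0, ∀ t ∈ Set.Ioo a b, ∀ φ, poleFun (t - t₀) φ ≠ 0 →
      poleFun (t - t₀) φ < ρ → η * Real.log (poleFun (t - t₀) φ) ≤ z t φ) :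
    ∀ t ∈ Set.Icc a b, ∀ φ, poleFun (t - t₀) φ ≠ 0 → m ≤ z t φ := by
  intro t₁ ht₁ φ₁ hS₁
  set Λ := Real.cosh (b - a) ^ 2 with hΛ
  set T := (b - a) ^ 2 with hT
  have hcontS : Continuous fun p : ℝ × ℝ => poleFun (p.1 - t₀) p.2 := by unfold poleFun; fun_prop
  have hlogle : ∀ t ∈ Set.Icc a b, ∀ φ, Real.log (poleFun (t - t₀) φ) ≤ Λ := by
    intro t ht φ
    refine (Real.log_le_self (poleFun_nonneg _ _)).trans (poleFun_le_cosh_sq ?_ φ)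
    rw [abs_le]; constructor <;> linarith [ht.1, ht.2, ht₀.1, ht₀.2]
  have hTle : ∀ t ∈ Set.Icc a b, (t - a) ^ 2 ≤ T := fun t ht =>
    pow_le_pow_left₀ (by linarith [ht.1]) (by linarith [ht.2]) 2
  -- The logarithm handles the poles, and the quadratic term makes the Laplacian strictly negative.
  -- Both errors are linear in `η`.
  have key : ∀ η > 0, m - η * (2 * Λ + T) ≤
      z t₁ φ₁ - 2 * η * Real.log (poleFun (t₁ - t₀) φ₁) - (0 + η * (t₁ - a) ^ 2) := by
    intro η hη
    obtain ⟨ρ, hρ, hsing⟩ := hsing η hη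
    -- The three bounds put the level set `poleFun = σ` where `hsing` applies, keep the given point
    -- in `Q`, and yield `z - 2η log σ ≥ -η log σ ≥ m` on that level set.
    set σ := min (ρ / 2) (min (poleFun (t₁ - t₀) φ₁) (Real.exp (-m / η))) with hσ
    have hσ0 : 0 < σ := lt_min (by linarith) (lt_min (poleFun_pos hS₁) (Real.exp_pos _))
    have hσρ : σ < ρ := (min_le_left _ _).trans_lt (by linarith)
    have hσS : σ ≤ poleFun (t₁ - t₀) φ₁ := (min_le_right _ _).trans (min_le_left _ _)
    have hσe : σ ≤ Real.exp (-m / η) := (min_le_right _ _).trans (min_le_right _ _)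
    have hΛ0 : 0 ≤ Λ := by positivity
    set Q : Set (ℝ × ℝ) := {p | p.1 ∈ Set.Icc a b ∧ σ ≤ poleFun (p.1 - t₀) p.2} with hQ
    have hQcl : IsClosed Q :=
      (isClosed_Icc.preimage continuous_fst).inter (isClosed_le continuous_const hcontS)
    have hQne : ∀ p ∈ Q, poleFun (p.1 - t₀) p.2 ≠ 0 := fun p hp => (hσ0.trans_le hp.2).ne'
    obtain ⟨p, hp, hmin⟩ := exists_isMinOn_of_periodic
      (h := fun t φ => z t φ - 2 * η * Real.log (poleFun (t - t₀) φ) - (0 + η * (t - a) ^ 2))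
      (Q := Q) (a := a) (b := b) Real.two_pi_pos
      (fun t φ => by simp only [hper, poleFun_add_two_pi])
      (fun t φ => by simp only [hQ, Set.mem_ofPred_eq, poleFun_add_two_pi])
      hQcl (fun p hp => hp.1) ⟨(t₁, φ₁), ht₁, hσS⟩ (by
        refine ((hcont.mono fun p hp => ⟨hp.1, hQne p hp⟩).sub (continuousOn_const.mul
          (hcontS.continuousOn.log hQne))).sub (by fun_prop))
    have h1 := hmin (show (t₁, φ₁) ∈ Q from ⟨ht₁, hσS⟩)
    simp only [Set.mem_ofPred_eq] at h1
    refine le_trans ?_ h1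
    by_contra! hlt
    have l1 := mul_le_mul_of_nonneg_left (hlogle _ hp.1 p.2) hη.le
    have l2 := mul_le_mul_of_nonneg_left (hTle _ hp.1) hη.le
    have hpI : p.1 ∈ Set.Ioo a b := by
      refine ⟨lt_of_le_of_ne hp.1.1 ?_, lt_of_le_of_ne hp.1.2 ?_⟩
      · intro e
        have := ha p.2
        rw [e] at this
        linarith
      · intro e
        have := hb p.2
        rw [← e] at this
        linarith
    have hpσ : σ < poleFun (p.1 - t₀) p.2 := by
      refine lt_of_le_of_ne hp.2 fun e => ?_
      have h2 := hsing p.1 hpI p.2 (hQne p hp) (by rw [← e]; exact hσρ)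
      have h3 : Real.log σ ≤ -m / η := by
        rw [← Real.log_exp (-m / η)]; exact Real.log_le_log hσ0 hσe
      rw [le_div_iff₀ hη] at h3
      rw [← e] at h2 hlt
      have := mul_nonneg hη.le hΛ0
      linarith
    obtain ⟨L, hL, hL0⟩ := hlap p.1 hpI p.2 (hQne p hp)
    have hL' := (hL.sub ((hasLaplacianAt_log_poleFun (hQne p hp)).const_mul (2 * η))).sub
      ((hasSecondDerivAt_quadratic 0 η a p.1).hasLaplacianAt_fst p.2)
    have := hL'.nonneg_of_isMinOn (Q := Q)
      (U := {q | q.1 ∈ Set.Ioo a b ∧ σ < poleFun (q.1 - t₀) q.2}) hmin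
      ((isOpen_Ioo.preimage continuous_fst).inter (isOpen_lt continuous_const hcontS)) ⟨hpI, hpσ⟩
      (fun q hq => ⟨Set.Ioo_subset_Icc_self hq.1, hq.2.le⟩)
    linarith
  by_contra! hlt
  -- The total error is at most `η X`; the `η` below keeps it under half of the supposed gap `m - z
  -- t₁ φ₁`.
  set X := 2 * Λ + T - 2 * Real.log (poleFun (t₁ - t₀) φ₁) with hX
  have hη : 0 < (m - z t₁ φ₁) / (2 * (|X| + 1)) := div_pos (by linarith) (by positivity)
  have := key _ hη
  set η := (m - z t₁ φ₁) / (2 * (|X| + 1)) with hηdef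
  have e : η * (2 * (|X| + 1)) = m - z t₁ φ₁ := by rw [hηdef]; field_simp
  have h1 : η * X ≤ η * |X| := mul_le_mul_of_nonneg_left (le_abs_self X) hη.le
  have h2 : 0 ≤ η * |X| := by positivity
  have h3 : 0 ≤ η * (t₁ - a) ^ 2 := by positivity
  have h4 : η * X = η * (2 * Λ + T) - 2 * η * Real.log (poleFun (t₁ - t₀) φ₁) := by rw [hX]; ring
  linarith

/-! ### The strong minimum principle -/

theorem hasSecondDerivAt_inv_sq_add {x c t : ℝ} (h : (t - x) ^ 2 + c ≠ 0) :
    HasSecondDerivAt (fun s => ((s - x) ^ 2 + c)⁻¹)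
      ((8 * (t - x) ^ 2 - 2 * ((t - x) ^ 2 + c)) / ((t - x) ^ 2 + c) ^ 3) t := by
  have d : ∀ s, HasDerivAt (fun s => (s - x) ^ 2 + c) (2 * (s - x)) s := by
    intro s
    exact ((((hasDerivAt_id s).sub_const x).pow 2).add_const c).congr_deriv (by simp)
  have hc : Continuous fun s => (s - x) ^ 2 + c := by fun_prop
  refine ⟨fun s => -(2 * (s - x)) / ((s - x) ^ 2 + c) ^ 2, ?_, ?_⟩
  · filter_upwards [hc.continuousAt.eventually_ne h] with s hs using (d s).inv hs
  · have := ((((hasDerivAt_id t).sub_const x).const_mul 2).neg).div ((d t).pow 2) (pow_ne_zero 2 h)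
    refine this.congr_deriv ?_
    simp
    field_simp
    ring

/-- In the plane `r⁻²` is strictly subharmonic, unlike `log r`, so the barrier in the next lemma
needs no further perturbation. -/
theorem hasLaplacianAt_inv_distSq {x y t φ : ℝ} (h : (t - x) ^ 2 + (φ - y) ^ 2 ≠ 0) :
    HasLaplacianAt (fun t φ => ((t - x) ^ 2 + (φ - y) ^ 2)⁻¹) t φ
      (4 * (((t - x) ^ 2 + (φ - y) ^ 2)⁻¹) ^ 2) := by
  have h' : (φ - y) ^ 2 + (t - x) ^ 2 ≠ 0 := by rwa [add_comm]
  refine ⟨_, (8 * (φ - y) ^ 2 - 2 * ((φ - y) ^ 2 + (t - x) ^ 2)) /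
    ((φ - y) ^ 2 + (t - x) ^ 2) ^ 3, hasSecondDerivAt_inv_sq_add h, ?_, ?_⟩
  · have := hasSecondDerivAt_inv_sq_add h'
    simpa only [add_comm] using this
  · rw [add_comm ((φ - y) ^ 2)]
    field_simp
    ring

/-- Positivity of a nonnegative superharmonic function at the centre of a disc spreads to the
whole disc. -/
theorem pos_of_pos_center {z : ℝ → ℝ → ℝ} {D : Set (ℝ × ℝ)} {x y R : ℝ}
    (hsub : ∀ p : ℝ × ℝ, (p.1 - x) ^ 2 + (p.2 - y) ^ 2 ≤ R ^ 2 → p ∈ D)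
    (hcont : ContinuousOn (fun p : ℝ × ℝ => z p.1 p.2) D) (hD : IsOpen D)
    (hnonneg : ∀ p ∈ D, 0 ≤ z p.1 p.2)
    (hlap : ∀ p ∈ D, ∃ L, HasLaplacianAt z p.1 p.2 L ∧ L ≤ 0) (hpos : 0 < z x y)
    {p : ℝ × ℝ} (hp : (p.1 - x) ^ 2 + (p.2 - y) ^ 2 < R ^ 2) : 0 < z p.1 p.2 := by
  set N : ℝ × ℝ → ℝ := fun q => (q.1 - x) ^ 2 + (q.2 - y) ^ 2 with hN
  have hNc : Continuous N := by fun_prop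
  by_cases hp0 : N p = 0
  · have h1 : (p.1 - x) ^ 2 = 0 := by
      have : (p.1 - x) ^ 2 + (p.2 - y) ^ 2 = 0 := hp0
      nlinarith [sq_nonneg (p.1 - x), sq_nonneg (p.2 - y)]
    have h2 : (p.2 - y) ^ 2 = 0 := by
      have : (p.1 - x) ^ 2 + (p.2 - y) ^ 2 = 0 := hp0
      nlinarith [sq_nonneg (p.1 - x), sq_nonneg (p.2 - y)]
    rw [sub_eq_zero.1 (pow_eq_zero_iff two_ne_zero |>.1 h1),
      sub_eq_zero.1 (pow_eq_zero_iff two_ne_zero |>.1 h2)]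
    exact hpos
  have hNp : 0 < N p := lt_of_le_of_ne (by positivity) (Ne.symm hp0)
  have hR : 0 < R ^ 2 := hNp.trans hp
  have hxD : (x, y) ∈ D := hsub _ (by simpa using hR.le)
  have hev : ∀ᶠ q in 𝓝 (x, y), z x y / 2 < z q.1 q.2 :=
    ((hcont.continuousAt (hD.mem_nhds hxD)).eventually (lt_mem_nhds (by simpa using half_lt_self hpos)))
  obtain ⟨r, hr, hball⟩ := Metric.eventually_nhds_iff.1 hev
  set σ := min (N p / 2) (r ^ 2 / 2) with hσ
  have hσ0 : 0 < σ := lt_min (by linarith) (by positivity)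
  have hσN : σ < N p := (min_le_left _ _).trans_lt (by linarith)
  have hσr : σ < r ^ 2 := (min_le_right _ _).trans_lt (by nlinarith)
  have hinner : ∀ q, N q ≤ σ → z x y / 2 < z q.1 q.2 := by
    intro q hq
    apply hball
    have hq' : (q.1 - x) ^ 2 + (q.2 - y) ^ 2 < r ^ 2 := lt_of_le_of_lt hq hσr
    rw [Prod.dist_eq, max_lt_iff, Real.dist_eq, Real.dist_eq]
    exact ⟨abs_lt_of_sq_lt_sq (by nlinarith [sq_nonneg (q.2 - y)]) hr.le,
      abs_lt_of_sq_lt_sq (by nlinarith [sq_nonneg (q.1 - x)]) hr.le⟩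
  -- With this `k`, `z - k / N` is positive on the inner circle and at least `-k / R²` on the outer
  -- one; an interior minimum is impossible since its Laplacian is negative.
  set k := z x y / 2 * σ with hk
  have hk0 : 0 < k := by positivity
  set Q : Set (ℝ × ℝ) := {q | σ ≤ N q ∧ N q ≤ R ^ 2} with hQ
  have hQcl : IsClosed Q := (isClosed_le continuous_const hNc).inter (isClosed_le hNc continuous_const)
  have hQcomp : IsCompact Q := by
    refine IsCompact.of_isClosed_subset (isCompact_closedBall (x, y) |R|) hQcl fun q hq => ?_
    have hq2 : (q.1 - x) ^ 2 + (q.2 - y) ^ 2 ≤ R ^ 2 := hq.2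
    rw [Metric.mem_closedBall, Prod.dist_eq, max_le_iff, Real.dist_eq, Real.dist_eq]
    exact ⟨sq_le_sq.1 (by nlinarith [sq_nonneg (q.2 - y)]),
      sq_le_sq.1 (by nlinarith [sq_nonneg (q.1 - x)])⟩
  have hQ0 : ∀ q ∈ Q, N q ≠ 0 := fun q hq => (hσ0.trans_le hq.1).ne'
  have hpQ : p ∈ Q := ⟨hσN.le, hp.le⟩
  obtain ⟨q, hq, hmin⟩ := hQcomp.exists_isMinOn
    (f := fun q : ℝ × ℝ => z q.1 q.2 - k * (N q)⁻¹) ⟨p, hpQ⟩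
    ((hcont.mono fun q hq => hsub q hq.2).sub (continuousOn_const.mul (hNc.continuousOn.inv₀ hQ0)))
  have hqp : z q.1 q.2 - k * (N q)⁻¹ ≤ z p.1 p.2 - k * (N p)⁻¹ := hmin hpQ
  have hmain : -(k * (R ^ 2)⁻¹) ≤ z q.1 q.2 - k * (N q)⁻¹ := by
    rcases eq_or_lt_of_le hq.1 with e | hlt
    · have h1 := hinner q e.symm.le
      have h2 : k * (N q)⁻¹ = z x y / 2 := by rw [← e, hk]; field_simp
      have : 0 < k * (R ^ 2)⁻¹ := by positivity
      linarith
    rcases eq_or_lt_of_le hq.2 with e | hlt2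
    · rw [e]
      have := hnonneg q (hsub q hq.2)
      linarith
    exfalso
    obtain ⟨L, hL, hL0⟩ := hlap q (hsub q hq.2)
    have hL' := hL.sub ((hasLaplacianAt_inv_distSq (hQ0 q hq)).const_mul k)
    have := hL'.nonneg_of_isMinOn (Q := Q) (U := {q | σ < N q ∧ N q < R ^ 2}) hmin
      ((isOpen_lt continuous_const hNc).inter (isOpen_lt hNc continuous_const)) ⟨hlt, hlt2⟩
      (fun q hq => ⟨hq.1.le, hq.2.le⟩)
    have h4 : 0 < k * (4 * ((N q)⁻¹) ^ 2) := by
      have := lt_of_le_of_ne (show 0 ≤ N q by positivity) (hQ0 q hq).symm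
      positivity
    have h5 : k * (4 * ((N q)⁻¹) ^ 2) = k * (4 * ((q.1 - x) ^ 2 + (q.2 - y) ^ 2)⁻¹ ^ 2) := rfl
    linarith
  have : k * (R ^ 2)⁻¹ < k * (N p)⁻¹ := mul_lt_mul_of_pos_left ((inv_lt_inv₀ hR hNp).2 hp) hk0
  linarith

/-- Strong minimum principle: a nonnegative superharmonic function on a connected open set is
positive or vanishes identically. -/
theorem pos_of_superharmonic {z : ℝ → ℝ → ℝ} {D : Set (ℝ × ℝ)} (hD : IsOpen D)
    (hDc : IsPreconnected D) (hcont : ContinuousOn (fun p : ℝ × ℝ => z p.1 p.2) D)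
    (hnonneg : ∀ p ∈ D, 0 ≤ z p.1 p.2)
    (hlap : ∀ p ∈ D, ∃ L, HasLaplacianAt z p.1 p.2 L ∧ L ≤ 0)
    {q : ℝ × ℝ} (hq : q ∈ D) (hqpos : 0 < z q.1 q.2) : ∀ p ∈ D, 0 < z p.1 p.2 := by
  set U : Set (ℝ × ℝ) := {p | p ∈ D ∧ 0 < z p.1 p.2} with hU
  set V : Set (ℝ × ℝ) := {p | p ∈ D ∧ z p.1 p.2 = 0} with hV
  have hUo : IsOpen U := hcont.isOpen_inter_preimage hD isOpen_Ioi
  -- A positive point within `r / 4` of a zero `p` is the centre of a disc of radius `r / 2`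
  -- containing `p`, which would make `z` positive at `p`.
  have hVo : IsOpen V := by
    rw [Metric.isOpen_iff]
    rintro p ⟨hpD, hp0⟩
    obtain ⟨r, hr, hrD⟩ := Metric.isOpen_iff.1 hD p hpD
    refine ⟨r / 4, by linarith, fun p₁ hp₁ => ?_⟩
    have hp₁D : p₁ ∈ D := hrD (Metric.ball_subset_ball (by linarith) hp₁)
    refine ⟨hp₁D, ?_⟩
    by_contra hne
    have hpos : 0 < z p₁.1 p₁.2 := lt_of_le_of_ne (hnonneg _ hp₁D) (Ne.symm hne)
    rw [Metric.mem_ball, Prod.dist_eq, max_lt_iff, Real.dist_eq, Real.dist_eq] at hp₁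
    have e1 := abs_lt.1 hp₁.1
    have e2 := abs_lt.1 hp₁.2
    have := pos_of_pos_center (x := p₁.1) (y := p₁.2) (R := r / 2) (p := p) ?_ hcont hD hnonneg hlap
      hpos ?_
    · linarith
    · intro p₂ hp₂
      apply hrD
      have f1 := abs_le.1 (abs_le_of_sq_le_sq (show (p₂.1 - p₁.1) ^ 2 ≤ (r / 2) ^ 2 by
        nlinarith [sq_nonneg (p₂.2 - p₁.2)]) (by linarith))
      have f2 := abs_le.1 (abs_le_of_sq_le_sq (show (p₂.2 - p₁.2) ^ 2 ≤ (r / 2) ^ 2 by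
        nlinarith [sq_nonneg (p₂.1 - p₁.1)]) (by linarith))
      rw [Metric.mem_ball, Prod.dist_eq, max_lt_iff, Real.dist_eq, Real.dist_eq, abs_lt, abs_lt]
      refine ⟨⟨?_, ?_⟩, ?_, ?_⟩ <;> linarith
    · have g1 : (p.1 - p₁.1) ^ 2 < (r / 4) ^ 2 := sq_lt_sq' (by linarith) (by linarith)
      have g2 : (p.2 - p₁.2) ^ 2 < (r / 4) ^ 2 := sq_lt_sq' (by linarith) (by linarith)
      nlinarith
  have hDU : D ⊆ U := by
    refine hDc.subset_left_of_subset_union hUo hVo ?_ ?_ ⟨q, hq, hq, hqpos⟩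
    · rw [Set.disjoint_left]
      rintro p ⟨-, h1⟩ ⟨-, h2⟩
      linarith
    · intro p hp
      rcases eq_or_lt_of_le (hnonneg p hp) with h | h
      · exact Or.inr ⟨hp, h.symm⟩
      · exact Or.inl ⟨hp, h⟩
  exact fun p hp => (hDU hp).2

/-- A half-plane minus the translated poles is connected. -/
theorem isPreconnected_halfPlane_diff_poles (τ t₀ : ℝ) :
    IsPreconnected {p : ℝ × ℝ | p.1 < τ ∧ poleFun (p.1 - t₀) p.2 ≠ 0} := by
  -- `g` maps the whole plane injectively onto the half-plane, so connectedness of the complement of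
  -- a countable set in the plane carries over.
  set g : ℝ × ℝ → ℝ × ℝ := fun p => (τ - Real.exp p.1, p.2) with hg
  have hgc : Continuous g := by fun_prop
  have hginj : Function.Injective g := by
    rintro ⟨a, b⟩ ⟨a', b'⟩ h
    simpa [hg] using h
  set C : Set (ℝ × ℝ) := {p | poleFun (p.1 - t₀) p.2 = 0} with hC
  have hCc : C.Countable := by
    refine (Set.countable_range fun k : ℤ => ((t₀, k * Real.pi) : ℝ × ℝ)).mono ?_
    rintro ⟨t, φ⟩ h
    have h' : Real.sinh (t - t₀) ^ 2 + Real.sin φ ^ 2 = 0 := h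
    have h1 : Real.sinh (t - t₀) = 0 := by
      refine pow_eq_zero_iff two_ne_zero |>.1 ?_
      nlinarith [sq_nonneg (Real.sinh (t - t₀)), sq_nonneg (Real.sin φ)]
    have h2 : Real.sin φ = 0 := by
      refine pow_eq_zero_iff two_ne_zero |>.1 ?_
      nlinarith [sq_nonneg (Real.sinh (t - t₀)), sq_nonneg (Real.sin φ)]
    obtain ⟨k, hk⟩ := Real.sin_eq_zero_iff.1 h2
    rw [Real.sinh_eq_zero, sub_eq_zero] at h1
    exact ⟨k, by simp [h1, hk]⟩
  have hrank : 1 < Module.rank ℝ (ℝ × ℝ) := by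
    rw [rank_prod', Module.rank_self]
    exact_mod_cast one_lt_two
  have hconn := ((hCc.preimage_of_injOn (f := g) hginj.injOn).isConnected_compl_of_one_lt_rank
    hrank).isPreconnected.image g hgc.continuousOn
  convert hconn using 1
  ext ⟨t, φ⟩
  constructor
  · rintro ⟨h1, h2⟩
    have e : g (Real.log (τ - t), φ) = (t, φ) := by
      have : Real.exp (Real.log (τ - t)) = τ - t := Real.exp_log (sub_pos.2 h1)
      simp [hg, this]
    refine ⟨(Real.log (τ - t), φ), ?_, e⟩
    show g (Real.log (τ - t), φ) ∉ C
    rw [e]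
    exact h2
  · rintro ⟨p, hp, e⟩
    have hp' : g p ∉ C := hp
    rw [e] at hp'
    refine ⟨?_, hp'⟩
    have : τ - Real.exp p.1 = t := congrArg Prod.fst e
    have := Real.exp_pos p.1
    show t < τ
    linarith

/-! ### Moving planes on the cylinder -/

/-- Solutions of `-Δw = K e^{2w} + F` on the cylinder `ℝ × ℝ/2πℤ` with the points `(0, kπ)` removed,
whose data increase towards `t = 0`, together with the a priori information on the behaviour at the
ends and at the removed points that the method of moving planes needs. -/
structure CylinderSolution (w K F : ℝ → ℝ → ℝ) : Prop where
  periodic : ∀ t φ, w t (φ + 2 * Real.pi) = w t φ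
  continuousOn : ContinuousOn (fun p : ℝ × ℝ => w p.1 p.2) {p | poleFun p.1 p.2 ≠ 0}
  hasLaplacianAt : ∀ t φ, poleFun t φ ≠ 0 →
    HasLaplacianAt w t φ (-(K t φ * Real.exp (2 * w t φ) + F t φ))
  K_nonneg : ∀ t φ, poleFun t φ ≠ 0 → 0 ≤ K t φ
  F_nonneg : ∀ t φ, poleFun t φ ≠ 0 → 0 ≤ F t φ
  K_mono : ∀ t y φ, t < y → y < -t → poleFun y φ ≠ 0 → K t φ ≤ K y φ
  F_mono : ∀ t y φ, t < y → y < -t → poleFun y φ ≠ 0 → F t φ ≤ F y φ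
  coeff_le : ∀ T < 0, ∃ C > 0, ∀ t ≤ T, ∀ φ, 2 * K t φ * Real.exp (2 * w t φ) ≤ C / Real.cosh t ^ 2
  le_const : ∃ M, ∀ t ≤ -1, ∀ φ, w t φ + Real.log (Real.cosh t) ≤ M
  const_le : ∃ m, ∀ t φ, 1 ≤ |t| → m ≤ w t φ + Real.log (Real.cosh t)
  log_le : ∀ η > 0, ∃ ρ > 0, ∀ t φ, poleFun t φ ≠ 0 → poleFun t φ < ρ →
    η * Real.log (poleFun t φ) ≤ w t φ
  uniform : ∀ T < 0, ∀ ε > 0, ∃ δ > 0, ∀ t ≤ T, ∀ s, 0 ≤ s → s ≤ δ → ∀ φ,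
    |w (t - s) φ - w t φ| ≤ ε
  nondegenerate : ∀ τ < 0, ∃ t < τ, ∃ φ, poleFun (t - 2 * τ) φ ≠ 0 ∧ w (2 * τ - t) φ ≠ w t φ

/-- The difference between `w` reflected in `t = τ` and `w`. -/
def reflDiff (w : ℝ → ℝ → ℝ) (τ t φ : ℝ) : ℝ := w (2 * τ - t) φ - w t φ

theorem poleFun_neg (t φ : ℝ) : poleFun (-t) φ = poleFun t φ := by simp [poleFun]

theorem poleFun_sub_comm (s t φ : ℝ) : poleFun (s - t) φ = poleFun (t - s) φ := by
  rw [← poleFun_neg, neg_sub]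

theorem log_cosh_le_abs (t : ℝ) : Real.log (Real.cosh t) ≤ |t| := by
  rw [Real.log_le_iff_le_exp (Real.cosh_pos t), ← Real.cosh_abs, Real.cosh_eq]
  have := Real.exp_le_exp.2 (show -|t| ≤ |t| by linarith [abs_nonneg t])
  linarith

theorem abs_sub_log_two_le_log_cosh (t : ℝ) : |t| - Real.log 2 ≤ Real.log (Real.cosh t) := by
  rw [Real.le_log_iff_exp_le (Real.cosh_pos t), Real.exp_sub, Real.exp_log two_pos,
    ← Real.cosh_abs, Real.cosh_eq]
  have := Real.exp_pos (-|t|)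
  linarith

theorem hasSecondDerivAt_affine (α β t : ℝ) : HasSecondDerivAt (fun s => α + β * s) 0 t :=
  ⟨fun _ => β, Eventually.of_forall fun s =>
    (((hasDerivAt_id s).const_mul β).const_add α).congr_deriv (by simp), hasDerivAt_const t β⟩

/-! ### Reflection differences: start, continuation and limit of the moving plane. -/

namespace CylinderSolution

variable {w K F : ℝ → ℝ → ℝ}

theorem reflDiff_periodic (h : CylinderSolution w K F) (τ t φ : ℝ) :
    reflDiff w τ t (φ + 2 * Real.pi) = reflDiff w τ t φ := by
  simp only [reflDiff, h.periodic]

theorem continuousOn_reflDiff (h : CylinderSolution w K F) (τ : ℝ) :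
    ContinuousOn (fun p : ℝ × ℝ => reflDiff w τ p.1 p.2)
      {p | p.1 < 0 ∧ poleFun (p.1 - 2 * τ) p.2 ≠ 0} := by
  refine ContinuousOn.sub ?_ (h.continuousOn.mono fun p hp => poleFun_ne_zero_of_ne hp.1.ne _)
  refine h.continuousOn.comp (f := fun p : ℝ × ℝ => (2 * τ - p.1, p.2)) (by fun_prop) ?_
  intro p hp
  show poleFun (2 * τ - p.1) p.2 ≠ 0
  rw [poleFun_sub_comm]
  exact hp.2

/-- The reflected point is closer to `t = 0`, so its data are larger; the tangent line bound `e^{2a}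
≥ e^{2b}(1 + 2(a - b))` then linearises the exponential, whatever the sign of `a - b`. -/
theorem hasLaplacianAt_reflDiff (h : CylinderSolution w K F) {τ t φ : ℝ} (hτ : τ < 0) (ht : t < τ)
    (hp : poleFun (t - 2 * τ) φ ≠ 0) : ∃ L, HasLaplacianAt (reflDiff w τ) t φ L ∧
      L ≤ -(2 * K t φ * Real.exp (2 * w t φ) * reflDiff w τ t φ) := by
  have hp' : poleFun (2 * τ - t) φ ≠ 0 := by rwa [poleFun_sub_comm]
  have hpt : poleFun t φ ≠ 0 := poleFun_ne_zero_of_ne (by linarith) φ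
  refine ⟨_, ((h.hasLaplacianAt _ _ hp').comp_const_sub (2 * τ)).sub (h.hasLaplacianAt _ _ hpt), ?_⟩
  have hK := h.K_mono t (2 * τ - t) φ (by linarith) (by linarith) hp'
  have hF := h.F_mono t (2 * τ - t) φ (by linarith) (by linarith) hp'
  have hK0 := h.K_nonneg t φ hpt
  set a := w (2 * τ - t) φ with ha
  set b := w t φ with hb
  have h1 : K t φ * Real.exp (2 * a) ≤ K (2 * τ - t) φ * Real.exp (2 * a) :=
    mul_le_mul_of_nonneg_right hK (Real.exp_pos _).le
  have h2 : Real.exp (2 * b) * (1 + 2 * (a - b)) ≤ Real.exp (2 * a) := by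
    have := mul_le_mul_of_nonneg_left (Real.add_one_le_exp (2 * (a - b))) (Real.exp_pos (2 * b)).le
    rw [← Real.exp_add] at this
    calc _ = Real.exp (2 * b) * (2 * (a - b) + 1) := by ring
      _ ≤ _ := this
      _ = _ := by ring_nf
  have h3 := mul_le_mul_of_nonneg_left h2 hK0
  simp only [reflDiff, ← ha, ← hb]
  linarith

/-- `w` itself is superharmonic, so the singular minimum principle extends the bound from `|t| ≥ 1`
across the poles. -/
theorem exists_lower_bound (h : CylinderSolution w K F) :
    ∃ m, ∀ t φ, poleFun t φ ≠ 0 → m ≤ w t φ + Real.log (Real.cosh t) := by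
  obtain ⟨m, hm⟩ := h.const_le
  have hlog : ∀ t, 0 ≤ Real.log (Real.cosh t) := fun t => Real.log_nonneg (Real.one_le_cosh t)
  refine ⟨m - Real.log (Real.cosh 1), fun t φ hp => ?_⟩
  rcases le_or_gt 1 |t| with ht | ht
  · linarith [hm t φ ht, hlog 1]
  have := le_of_superharmonic_of_log_le (z := w) (a := -1) (b := 1) (t₀ := 0)
    (m := m - Real.log (Real.cosh 1)) (by norm_num) h.periodic ?_ ?_ ?_ ?_ ?_ t
    (Set.mem_Icc.2 (abs_le.1 ht.le)) φ (by simpa using hp)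
  · linarith [hlog t]
  · exact h.continuousOn.mono fun p hp => by simpa using hp.2
  · intro φ
    have := hm (-1) φ (by simp)
    rw [Real.cosh_neg] at this
    linarith
  · intro φ
    linarith [hm 1 φ (by simp)]
  · intro t _ φ hp
    rw [sub_zero] at hp
    refine ⟨_, h.hasLaplacianAt t φ hp, ?_⟩
    have := mul_nonneg (h.K_nonneg t φ hp) (Real.exp_pos (2 * w t φ)).le
    linarith [h.F_nonneg t φ hp]
  · intro η hη
    obtain ⟨ρ, hρ, H⟩ := h.log_le η hη
    refine ⟨ρ, hρ, fun t _ φ h1 h2 => ?_⟩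
    rw [sub_zero] at h1 h2 ⊢
    exact H t φ h1 h2

/-- `haτ` places the reflected poles to the left of the strip, and the difference vanishes on `t =
τ`. -/
theorem reflDiff_nonneg_of_narrow (h : CylinderSolution w K F) {τ a C : ℝ} (hτ : τ < 0)
    (haτ : 2 * τ - a < 0) (hC : 0 < C) (hnarrow : C * (τ - a) ^ 2 ≤ 1)
    (hcoeff : ∀ t ∈ Set.Ioo a τ, ∀ φ, 2 * K t φ * Real.exp (2 * w t φ) ≤ C)
    (ha : ∀ φ, 0 ≤ reflDiff w τ a φ) : ∀ t ∈ Set.Icc a τ, ∀ φ, 0 ≤ reflDiff w τ t φ := by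
  have hpole : ∀ t, a ≤ t → ∀ φ, poleFun (t - 2 * τ) φ ≠ 0 := fun t ht φ =>
    poleFun_ne_zero_of_ne (by linarith) φ
  refine nonneg_of_narrow_strip (c := fun t φ => 2 * K t φ * Real.exp (2 * w t φ)) Real.two_pi_pos
    (h.reflDiff_periodic τ) ?_ hC hnarrow ha ?_ ?_ ?_
  · exact (h.continuousOn_reflDiff τ).mono fun p hp =>
      ⟨lt_of_le_of_lt hp.1.2 hτ, hpole p.1 hp.1.1 p.2⟩
  · intro φ
    have : 2 * τ - τ = τ := by ring
    simp [reflDiff, this]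
  · intro t ht φ
    have := h.K_nonneg t φ (poleFun_ne_zero_of_ne (ht.2.trans hτ).ne φ)
    exact ⟨by positivity, hcoeff t ht φ⟩
  · intro t ht φ
    exact h.hasLaplacianAt_reflDiff hτ ht.2 (hpole t ht.1.le φ)

/-- The reflection inequality at the position `τ` of the moving plane. -/
def ReflNonneg (w : ℝ → ℝ → ℝ) (τ : ℝ) : Prop :=
  ∀ t < τ, ∀ φ, poleFun (t - 2 * τ) φ ≠ 0 → 0 ≤ reflDiff w τ t φ

theorem sq_le_cosh_sq (t : ℝ) : t ^ 2 ≤ Real.cosh t ^ 2 := by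
  have h1 : |t| ≤ Real.sinh |t| := Real.self_le_sinh_iff.2 (abs_nonneg t)
  have h2 := pow_le_pow_left₀ (abs_nonneg t) h1 2
  have h3 := Real.cosh_sq |t|
  rw [Real.cosh_abs] at h3
  rw [sq_abs] at h2
  linarith

/-- At distance at least `A` from the plane, the bounds on `w + log cosh t` decide the sign. The
remaining strip has fixed width `A`, while the coefficient decays like `cosh⁻² σ`. -/
theorem exists_start (h : CylinderSolution w K F) : ∃ τ < 0, ∀ σ ≤ τ, ReflNonneg w σ := by
  obtain ⟨m, hm⟩ := h.exists_lower_bound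
  obtain ⟨M, hM⟩ := h.le_const
  obtain ⟨C, hC, hcoeff⟩ := h.coeff_le (-1) (by norm_num)
  set A := |(M - m + Real.log 2) / 2| + 1 with hA
  have hA1 : 1 ≤ A := by have := abs_nonneg ((M - m + Real.log 2) / 2); linarith
  have hA2 : M - m + Real.log 2 ≤ 2 * A := by
    have := le_abs_self ((M - m + Real.log 2) / 2); linarith
  have hCA : 0 < C * A ^ 2 := by positivity
  -- `|σ| > A` leaves the reflected poles in the far region; `|σ| ≥ 1` and `|σ| ≥ C A²` give `C A² ≤
  -- σ² ≤ cosh² σ`.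
  refine ⟨-(A + 1 + C * A ^ 2), by linarith, fun σ hσ => ?_⟩
  have hfar : ∀ t ≤ σ - A, ∀ φ, poleFun (t - 2 * σ) φ ≠ 0 → 0 ≤ reflDiff w σ t φ := by
    intro t ht φ hp
    rw [poleFun_sub_comm] at hp
    have h1 := hm _ φ hp
    have h2 := hM t (by linarith) φ
    have h3 := log_cosh_le_abs (2 * σ - t)
    have h4 := abs_sub_log_two_le_log_cosh t
    rw [abs_of_neg (by linarith : t < 0)] at h4
    unfold reflDiff
    rcases abs_cases (2 * σ - t) with ⟨e, -⟩ | ⟨e, -⟩ <;> rw [e] at h3 <;> linarith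
  have hcosh : 0 < Real.cosh σ ^ 2 := pow_pos (Real.cosh_pos σ) 2
  have hnear := h.reflDiff_nonneg_of_narrow (τ := σ) (a := σ - A) (C := C / Real.cosh σ ^ 2)
    (by linarith) (by linarith) (by positivity) (by
      rw [div_mul_eq_mul_div, div_le_one hcosh]
      have := sq_le_cosh_sq σ
      have e : σ - (σ - A) = A := by ring
      rw [e]
      nlinarith) (by
      intro t ht φ
      refine (hcoeff t (by linarith [ht.2]) φ).trans ?_
      have : Real.cosh σ ≤ Real.cosh t := Real.cosh_le_cosh.2 (by
        rw [abs_of_neg (by linarith : σ < 0), abs_of_neg (by linarith [ht.2] : t < 0)]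
        linarith [ht.2])
      exact div_le_div_of_nonneg_left hC.le hcosh
        (pow_le_pow_left₀ (Real.cosh_pos σ).le this 2)) (fun φ =>
      hfar _ le_rfl φ (poleFun_ne_zero_of_ne (by linarith) φ))
  intro t ht φ hp
  rcases le_or_gt t (σ - A) with h1 | h1
  · exact hfar t h1 φ hp
  · exact hnear t ⟨h1.le, ht.le⟩ φ

/-- A nonnegative difference is superharmonic because its coefficient is nonnegative, and
`nondegenerate` rules out the identically zero case. -/
theorem reflDiff_pos (h : CylinderSolution w K F) {τ : ℝ} (hτ : τ < 0) (hn : ReflNonneg w τ) :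
    ∀ t < τ, ∀ φ, poleFun (t - 2 * τ) φ ≠ 0 → 0 < reflDiff w τ t φ := by
  obtain ⟨t₀, ht₀, φ₀, hp₀, hne⟩ := h.nondegenerate τ hτ
  set D : Set (ℝ × ℝ) := {p : ℝ × ℝ | p.1 < τ ∧ poleFun (p.1 - 2 * τ) p.2 ≠ 0} with hD
  have hcontS : Continuous fun p : ℝ × ℝ => poleFun (p.1 - 2 * τ) p.2 := by
    unfold poleFun; fun_prop
  have hDo : IsOpen D := (isOpen_lt continuous_fst continuous_const).inter
    (isOpen_ne_fun hcontS continuous_const)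
  have hpos₀ : 0 < reflDiff w τ t₀ φ₀ :=
    lt_of_le_of_ne (hn t₀ ht₀ φ₀ hp₀) (sub_ne_zero.2 hne).symm
  intro t ht φ hp
  refine pos_of_superharmonic (z := reflDiff w τ) hDo
    (isPreconnected_halfPlane_diff_poles τ (2 * τ)) ?_ ?_ ?_
    (q := (t₀, φ₀)) ⟨ht₀, hp₀⟩ hpos₀ (t, φ) ⟨ht, hp⟩
  · exact (h.continuousOn_reflDiff τ).mono fun p hp => ⟨hp.1.trans hτ, hp.2⟩
  · exact fun p hp => hn _ hp.1 _ hp.2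
  · intro p hp
    obtain ⟨L, hL, hL'⟩ := h.hasLaplacianAt_reflDiff hτ hp.1 hp.2
    refine ⟨L, hL, hL'.trans ?_⟩
    have h1 := h.K_nonneg p.1 p.2 (poleFun_ne_zero_of_ne (hp.1.trans hτ).ne _)
    have h2 := hn _ hp.1 _ hp.2
    have : 0 ≤ 2 * K p.1 p.2 * Real.exp (2 * w p.1 p.2) * reflDiff w τ p.1 p.2 := by positivity
    linarith

/-- Away from the plane the difference is bounded below by a positive constant, up to the end of
the cylinder and up to the reflected poles. -/
theorem exists_pos_le_reflDiff (h : CylinderSolution w K F) {τ b : ℝ} (hτ : τ < 0)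
    (hn : ReflNonneg w τ) (hb : b < τ) (hb' : 2 * τ < b) :
    ∃ m > 0, ∀ t ≤ b, ∀ φ, poleFun (t - 2 * τ) φ ≠ 0 → m ≤ reflDiff w τ t φ := by
  have hpole : ∀ φ, poleFun (b - 2 * τ) φ ≠ 0 := poleFun_ne_zero_of_ne (by linarith)
  have hbper : ∀ p : ℝ × ℝ, p.1 = b → p.1 ∈ Set.Icc b b := fun p hp => by simp [hp]
  obtain ⟨p, hp, hmin⟩ := exists_isMinOn_of_periodic (h := reflDiff w τ) (Q := {p | p.1 = b})
    Real.two_pi_pos (h.reflDiff_periodic τ) (fun t φ => Iff.rfl)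
    (isClosed_eq continuous_fst continuous_const) hbper ⟨(b, 0), rfl⟩
    ((h.continuousOn_reflDiff τ).mono fun p (hp : p.1 = b) =>
      ⟨by rw [hp]; linarith, by rw [hp]; exact hpole _⟩)
  have hp' : p.1 = b := hp
  set m := reflDiff w τ p.1 p.2 with hm
  have hm0 : 0 < m := h.reflDiff_pos hτ hn _ (by rw [hp']; exact hb) _ (by rw [hp']; exact hpole _)
  have hmb : ∀ φ, m ≤ reflDiff w τ b φ := fun φ => hmin (show ((b, φ) : ℝ × ℝ).1 = b from rfl)
  refine ⟨m, hm0, fun t ht φ hpt => ?_⟩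
  -- The affine term is `m (b - t) / (b - a)`: it is `m` at `t = a`, where only `z ≥ 0` is known,
  -- and `0` at `t = b`. It disappears as `a → -∞`.
  have key : ∀ a, a < 2 * τ → a ≤ t → m ≤ reflDiff w τ t φ + (m * b / (b - a) + -m / (b - a) * t) := by
    intro a ha hat
    have hba : b - a ≠ 0 := by linarith
    refine le_of_superharmonic_of_log_le
      (z := fun t φ => reflDiff w τ t φ + (m * b / (b - a) + -m / (b - a) * t)) (a := a) (b := b)
      (t₀ := 2 * τ) ⟨ha, hb'⟩ (fun t φ => by rw [h.reflDiff_periodic]) ?_ ?_ ?_ ?_ ?_ t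
      ⟨hat, ht⟩ φ hpt
    · exact ((h.continuousOn_reflDiff τ).mono fun p hp => ⟨by linarith [hp.1.2], hp.2⟩).add
        (by fun_prop)
    · intro φ
      have e : m * b / (b - a) + -m / (b - a) * a = m := by field_simp; ring
      rw [e]
      have := hn a (by linarith) φ (poleFun_ne_zero_of_ne (by linarith) φ)
      linarith
    · intro φ
      have e : m * b / (b - a) + -m / (b - a) * b = 0 := by field_simp; ring
      rw [e, add_zero]
      exact hmb φ
    · intro s hs φ hps
      have hsτ : s < τ := hs.2.trans hb
      obtain ⟨L, hL, hL'⟩ := h.hasLaplacianAt_reflDiff hτ hsτ hps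
      refine ⟨_, hL.add ((hasSecondDerivAt_affine _ _ s).hasLaplacianAt_fst φ), ?_⟩
      have h1 := h.K_nonneg s φ (poleFun_ne_zero_of_ne (hsτ.trans hτ).ne _)
      have h2 := hn _ hsτ _ hps
      have : 0 ≤ 2 * K s φ * Real.exp (2 * w s φ) * reflDiff w τ s φ := by positivity
      linarith
    · intro η hη
      refine ⟨1, one_pos, fun s hs φ hps hlt => ?_⟩
      have h1 : Real.log (poleFun (s - 2 * τ) φ) ≤ 0 := Real.log_nonpos (poleFun_nonneg _ _) hlt.le
      have h2 := hn s (hs.2.trans hb) φ hps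
      have h3 : m * b / (b - a) + -m / (b - a) * s = m * (b - s) / (b - a) := by ring
      have h4 : 0 ≤ m * (b - s) / (b - a) :=
        div_nonneg (mul_nonneg hm0.le (by linarith [hs.2])) (by linarith)
      have h5 := mul_nonpos_of_nonneg_of_nonpos hη.le h1
      linarith
  by_contra! hlt
  set d := m - reflDiff w τ t φ with hd
  have hd0 : 0 < d := by linarith
  have hX : 0 ≤ m * (b - t) / d := div_nonneg (mul_nonneg hm0.le (by linarith)) hd0.le
  set a := min (2 * τ) t - 1 - m * (b - t) / d with ha
  have ha1 : a < 2 * τ := by linarith [min_le_left (2 * τ) t]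
  have ha2 : a ≤ t - 1 - m * (b - t) / d := by linarith [min_le_right (2 * τ) t]
  have h1 := key a ha1 (by linarith)
  have h2 : m * b / (b - a) + -m / (b - a) * t = m * (b - t) / (b - a) := by ring
  have h3 : d ≤ m * (b - t) / (b - a) := by rw [← h2]; linarith
  rw [le_div_iff₀ (by linarith)] at h3
  have h4 : d * (m * (b - t) / d) = m * (b - t) := by field_simp
  have h5 : d * (m * (b - t) / d) < d * (b - a) := mul_lt_mul_of_pos_left (by linarith) hd0
  linarith

/-- Reflecting `t` in `σ` is the same as reflecting `t - 2(σ - τ)` in `τ`. Thus the difference at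
`σ` is a translate of the one at `τ` up to a small shift of the unreflected `w`, where `w` is
uniformly continuous; no estimate near the moving poles is needed. -/
theorem exists_continue (h : CylinderSolution w K F) {τ : ℝ} (hτ : τ < 0) (hn : ReflNonneg w τ) :
    ∃ τ' > τ, ∀ σ, τ < σ → σ < τ' → ReflNonneg w σ := by
  obtain ⟨C, hC, hcoeff⟩ := h.coeff_le (τ / 2) (by linarith)
  -- The first bound keeps the strip `[τ - δ, σ]` inside `t ≤ τ / 2` and to the right of the
  -- reflected poles; the second gives `C (2δ)² ≤ 1`.
  set δ := min (-τ / 4) (1 / (2 * (C + 1))) with hδ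
  have hδ0 : 0 < δ := lt_min (by linarith) (by positivity)
  have hδ1 : δ ≤ -τ / 4 := min_le_left _ _
  have hδ2 : δ * (2 * (C + 1)) ≤ 1 := by
    rw [← le_div_iff₀ (by positivity)]; exact min_le_right _ _
  obtain ⟨m, hm, hmle⟩ := h.exists_pos_le_reflDiff (b := τ - δ) hτ hn (by linarith) (by linarith)
  obtain ⟨δ', hδ', hunif⟩ := h.uniform (τ - δ) (by linarith) m hm
  refine ⟨τ + min δ (δ' / 2), by linarith [lt_min hδ0 (half_pos hδ')], fun σ hσ hσ' => ?_⟩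
  have hσ1 : σ < τ + δ := by linarith [min_le_left δ (δ' / 2)]
  have hσ2 : σ < τ + δ' / 2 := by linarith [min_le_right δ (δ' / 2)]
  have hfar : ∀ t ≤ τ - δ, ∀ φ, poleFun (t - 2 * σ) φ ≠ 0 → 0 ≤ reflDiff w σ t φ := by
    intro t ht φ hp
    have e1 : t - 2 * (σ - τ) - 2 * τ = t - 2 * σ := by ring
    have e2 : 2 * τ - (t - 2 * (σ - τ)) = 2 * σ - t := by ring
    have h1 := hmle (t - 2 * (σ - τ)) (by linarith) φ (by rwa [e1])
    have h2 := (abs_le.1 (hunif t ht (2 * (σ - τ)) (by linarith) (by linarith) φ)).1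
    unfold reflDiff at h1 ⊢
    rw [e2] at h1
    linarith
  have hnear := h.reflDiff_nonneg_of_narrow (τ := σ) (a := τ - δ) (C := C) (by linarith)
    (by linarith) hC (by
      have h1 : (σ - (τ - δ)) ^ 2 ≤ (2 * δ) ^ 2 :=
        pow_le_pow_left₀ (by linarith) (by linarith) 2
      have h2 : (δ * (2 * (C + 1))) ^ 2 ≤ 1 := pow_le_one₀ (by positivity) hδ2
      have h3 : C ≤ (C + 1) ^ 2 := by nlinarith
      have h4 := mul_le_mul_of_nonneg_left h1 hC.le
      have h5 := mul_le_mul_of_nonneg_right h3 (sq_nonneg (2 * δ))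
      nlinarith) (fun t ht φ => by
      refine (hcoeff t (by linarith [ht.2]) φ).trans (div_le_self hC.le ?_)
      exact one_le_pow₀ (Real.one_le_cosh t)) (fun φ =>
      hfar _ le_rfl φ (poleFun_ne_zero_of_ne (by linarith) φ))
  intro t ht φ hp
  rcases le_or_gt t (τ - δ) with h1 | h1
  · exact hfar t h1 φ hp
  · exact hnear t ⟨h1.le, ht.le⟩ φ

theorem reflNonneg_of_forall_lt (h : CylinderSolution w K F) {τ : ℝ}
    (hlt : ∀ σ < τ, ReflNonneg w σ) : ReflNonneg w τ := by
  intro t ht φ hp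
  have hcontS : Continuous fun σ : ℝ => poleFun (t - 2 * σ) φ := by unfold poleFun; fun_prop
  have hp' : poleFun (2 * τ - t) φ ≠ 0 := by rwa [poleFun_sub_comm]
  have hopen : IsOpen {p : ℝ × ℝ | poleFun p.1 p.2 ≠ 0} :=
    isOpen_ne_fun continuous_poleFun continuous_const
  have hc : ContinuousAt (fun σ => reflDiff w σ t φ) τ := by
    refine ContinuousAt.sub ?_ continuousAt_const
    exact ContinuousAt.comp (f := fun σ : ℝ => ((2 * σ - t, φ) : ℝ × ℝ))
      (g := fun p : ℝ × ℝ => w p.1 p.2)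
      (h.continuousOn.continuousAt (hopen.mem_nhds hp')) (by fun_prop)
  refine ge_of_tendsto (hc.tendsto.mono_left (nhdsWithin_le_nhds (s := Set.Iio τ))) ?_
  filter_upwards [nhdsWithin_le_nhds (hcontS.continuousAt.eventually_ne hp),
    nhdsWithin_le_nhds (lt_mem_nhds ht), self_mem_nhdsWithin] with σ h1 h2 h3
  exact hlt σ h3 t h2 φ h1

/-- A solution on the cylinder lies below its reflection in `t = 0`. -/
theorem le_reflection (h : CylinderSolution w K F) {t : ℝ} (ht : t < 0) (φ : ℝ) :
    w t φ ≤ w (-t) φ := by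
  have hall : ∀ σ < 0, ReflNonneg w σ := by
    by_contra! hex
    set B : Set ℝ := {σ | σ < 0 ∧ ¬ ReflNonneg w σ} with hB
    have hBne : B.Nonempty := hex
    obtain ⟨τ₀, -, hstart⟩ := h.exists_start
    have hbdd : BddBelow B := ⟨τ₀, fun σ hσ => le_of_not_ge fun hle => hσ.2 (hstart σ hle)⟩
    have hs0 : sInf B < 0 := by
      obtain ⟨σ, hσ⟩ := hBne
      exact (csInf_le hbdd hσ).trans_lt hσ.1
    have hlt : ∀ σ < sInf B, ReflNonneg w σ := fun σ hσ => by
      by_contra hcon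
      exact (csInf_le hbdd ⟨hσ.trans hs0, hcon⟩).not_gt hσ
    have hs := h.reflNonneg_of_forall_lt hlt
    obtain ⟨τ', hτ', hcont⟩ := h.exists_continue hs0 hs
    have : τ' ≤ sInf B := by
      refine le_csInf hBne fun σ hσ => ?_
      by_contra! hσ'
      rcases lt_trichotomy σ (sInf B) with h1 | h1 | h1
      · exact hσ.2 (hlt σ h1)
      · exact hσ.2 (h1 ▸ hs)
      · exact hσ.2 (hcont σ h1 hσ')
    linarith
  have h0 := h.reflNonneg_of_forall_lt hall t ht φ
    (poleFun_ne_zero_of_ne (by simpa using ht.ne) φ)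
  simpa [reflDiff] using h0

end CylinderSolution

/-! ### The homogeneous extension and cylindrical coordinates -/

theorem homogExt_of_ne {v : S2 → ℝ} {x : E3} (hx : x ≠ 0) :
    homogExt v x = v (radialProj x hx) := dif_pos hx

theorem radialProj_coe (θ : S2) (h : (θ : E3) ≠ 0) : radialProj (θ : E3) h = θ := by
  ext1
  simp [radialProj]

theorem homogExt_coe (v : S2 → ℝ) (θ : S2) : homogExt v (θ : E3) = v θ := by
  have h : (θ : E3) ≠ 0 := ne_zero_of_mem_unit_sphere θ
  rw [homogExt_of_ne h, radialProj_coe]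

theorem homogExt_smul (v : S2 → ℝ) {x : E3} {c : ℝ} (hc : 0 < c) :
    homogExt v (c • x) = homogExt v x := by
  by_cases hx : x = 0
  · simp [hx]
  have hcx : c • x ≠ 0 := smul_ne_zero hc.ne' hx
  rw [homogExt_of_ne hx, homogExt_of_ne hcx]
  congr 1
  ext1
  simp only [radialProj, norm_smul, Real.norm_eq_abs, abs_of_pos hc, smul_smul]
  congr 1
  field_simp

theorem isOpen_puncturedSphere : IsOpen puncturedSphere :=
  (Set.toFinite _).isClosed.isOpen_compl

/-- Off the origin the extension is `v` composed with the smooth radial projection, taken on the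
open submanifold `{0}ᶜ`. -/
theorem contDiffAt_homogExt {v : S2 → ℝ} (hv : ContMDiffOn (𝓡 2) 𝓘(ℝ, ℝ) 2 v puncturedSphere)
    {θ : S2} (hθ : θ ∈ puncturedSphere) : ContDiffAt ℝ 2 (homogExt v) (θ : E3) := by
  let U : TopologicalSpace.Opens E3 := ⟨{0}ᶜ, isOpen_compl_singleton⟩
  have hU : ∀ x : U, (x : E3) ≠ 0 := fun x => x.2
  have hθ0 : (θ : E3) ≠ 0 := ne_zero_of_mem_unit_sphere θ
  have hg : ContMDiff 𝓘(ℝ, E3) 𝓘(ℝ, E3) 2 (fun x : U => (‖(x : E3)‖⁻¹ • (x : E3) : E3)) := by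
    intro x
    refine (contMDiffAt_subtype_iff (f := fun x : E3 => ‖x‖⁻¹ • x)).2 ?_
    refine ContDiffAt.contMDiffAt ?_
    exact ((contDiffAt_id.norm ℝ (hU x)).inv (norm_ne_zero_iff.2 (hU x))).smul contDiffAt_id
  have hr := hg.codRestrict_sphere (n := 2) (fun x => by simp [norm_smul, hU x])
  have hvθ : ContMDiffAt (𝓡 2) 𝓘(ℝ, ℝ) 2 v θ := hv.contMDiffAt (isOpen_puncturedSphere.mem_nhds hθ)
  let x₀ : U := ⟨(θ : E3), hθ0⟩
  have hx₀ : Set.codRestrict (fun x : U => (‖(x : E3)‖⁻¹ • (x : E3) : E3)) (Metric.sphere 0 1)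
      (fun x => by simp [norm_smul, hU x]) x₀ = θ := by
    ext1
    simp [x₀]
  have hcomp := ContMDiffAt.comp x₀ (by rw [hx₀]; exact hvθ) (hr x₀)
  rw [← contMDiffAt_iff_contDiffAt]
  refine (contMDiffAt_subtype_iff (U := U) (f := homogExt v) (x := x₀)).1 ?_
  refine hcomp.congr_of_eventuallyEq (Eventually.of_forall fun x => ?_)
  exact homogExt_of_ne (hU x)

/-- The second derivative of a `C²` function along a curve. -/
theorem hasSecondDerivAt_comp_curve {V : E3 → ℝ} {γ γ' : ℝ → E3} {γ'' : E3} {t : ℝ}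
    (hV : ContDiffAt ℝ 2 V (γ t)) (hγ : ∀ s, HasDerivAt γ (γ' s) s) (hγ' : HasDerivAt γ' γ'' t) :
    HasSecondDerivAt (fun s => V (γ s))
      (fderiv ℝ (fderiv ℝ V) (γ t) (γ' t) (γ' t) + fderiv ℝ V (γ t) γ'') t := by
  refine ⟨fun s => fderiv ℝ V (γ s) (γ' s), ?_, ?_⟩
  · have h1 : ∀ᶠ y in 𝓝 (γ t), ContDiffAt ℝ 2 V y := hV.eventually (by simp)
    filter_upwards [(hγ t).continuousAt.eventually h1] with s hs
    exact (hs.differentiableAt (by norm_num)).hasFDerivAt.comp_hasDerivAt s (hγ s)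
  · have h2 : DifferentiableAt ℝ (fderiv ℝ V) (γ t) :=
      (hV.fderiv_right (m := 1) (by norm_num)).differentiableAt (by norm_num)
    exact (h2.hasFDerivAt.comp_hasDerivAt t (hγ t)).clm_apply hγ'

theorem HasSecondDerivAt.unique {g : ℝ → ℝ} {A B t : ℝ} (h : HasSecondDerivAt g A t)
    (h' : HasSecondDerivAt g B t) : A = B := by
  obtain ⟨g₁, h1, h2⟩ := h
  obtain ⟨g₂, h3, h4⟩ := h'
  refine h2.unique (h4.congr_of_eventuallyEq ?_)
  filter_upwards [h1, h3] with s a b using a.unique b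

/-- The extension is constant along rays. -/
theorem fderiv_homogExt_self {v : S2 → ℝ} {x : E3} (hV : ContDiffAt ℝ 2 (homogExt v) x) :
    fderiv ℝ (homogExt v) x x = 0 ∧ fderiv ℝ (fderiv ℝ (homogExt v)) x x x = 0 := by
  have hγ : ∀ s : ℝ, HasDerivAt (fun s : ℝ => s • x) x s := fun s => by
    simpa using (hasDerivAt_id s).smul_const x
  have hev : (fun s : ℝ => homogExt v (s • x)) =ᶠ[𝓝 1] fun _ => homogExt v x := by
    filter_upwards [lt_mem_nhds (zero_lt_one' ℝ)] with s hs using homogExt_smul v hs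
  have hV1 : ContDiffAt ℝ 2 (homogExt v) ((fun s : ℝ => s • x) 1) := by simpa using hV
  constructor
  · have h1 := (hV1.differentiableAt (by norm_num)).hasFDerivAt.comp_hasDerivAt (1 : ℝ) (hγ 1)
    have h2 := (hasDerivAt_const (1 : ℝ) (homogExt v x)).congr_of_eventuallyEq hev
    simpa using h1.unique h2
  · have h1 := hasSecondDerivAt_comp_curve hV1 hγ (hasDerivAt_const 1 x)
    have h2 := (hasSecondDerivAt_const (homogExt v x) 1).congr_eventuallyEq hev
    simpa using h1.unique h2

/-- The conformal parametrization of the sphere by a cylinder with axis `b 0`. -/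
def cylinderMap (b : OrthonormalBasis (Fin 3) ℝ E3) (t φ : ℝ) : E3 :=
  (-Real.tanh t) • b 0 + (Real.cosh t)⁻¹ • (Real.sin φ • b 1 + Real.cos φ • b 2)

theorem hasDerivAt_inv_cosh (t : ℝ) :
    HasDerivAt (fun s => (Real.cosh s)⁻¹) (-Real.sinh t / Real.cosh t ^ 2) t :=
  (Real.hasDerivAt_cosh t).inv (Real.cosh_pos t).ne'

theorem hasDerivAt_neg_tanh (t : ℝ) :
    HasDerivAt (fun s => -Real.tanh s) (-(Real.cosh t ^ 2)⁻¹) t := by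
  have h := ((Real.hasDerivAt_sinh t).div (Real.hasDerivAt_cosh t) (Real.cosh_pos t).ne').neg
  have e : (fun s => -Real.tanh s) = -(Real.sinh / Real.cosh) := by
    ext s; simp [Real.tanh_eq_sinh_div_cosh]
  rw [e]
  refine h.congr_deriv ?_
  have := Real.cosh_sq t
  have := (Real.cosh_pos t).ne'
  field_simp
  linarith

theorem hasDerivAt_inv_cosh_sq (t : ℝ) :
    HasDerivAt (fun s => (Real.cosh s ^ 2)⁻¹) (-(2 * Real.sinh t) / Real.cosh t ^ 3) t := by
  have hc := (Real.cosh_pos t).ne'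
  refine (((Real.hasDerivAt_cosh t).pow 2).inv (pow_ne_zero 2 hc)).congr_deriv ?_
  simp
  field_simp

theorem hasDerivAt_sinh_div_cosh_sq (t : ℝ) :
    HasDerivAt (fun s => -Real.sinh s / Real.cosh s ^ 2)
      (-(Real.cosh t)⁻¹ + 2 * Real.sinh t ^ 2 / Real.cosh t ^ 3) t := by
  have hc := (Real.cosh_pos t).ne'
  refine ((Real.hasDerivAt_sinh t).neg.div ((Real.hasDerivAt_cosh t).pow 2)
    (pow_ne_zero 2 hc)).congr_deriv ?_
  simp
  field_simp

/-- The last two vectors are `cosh t` times the coordinate derivatives of `cylinderMap`, so this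
expresses conformality. -/
theorem orthonormal_cylinder_frame (b : OrthonormalBasis (Fin 3) ℝ E3) (t φ : ℝ) :
    Orthonormal ℝ ![cylinderMap b t φ,
      (-(Real.cosh t)⁻¹) • b 0 + (-Real.tanh t) • (Real.sin φ • b 1 + Real.cos φ • b 2),
      Real.cos φ • b 1 - Real.sin φ • b 2] := by
  have h1 := Real.cosh_sq t
  have h2 := Real.sin_sq_add_cos_sq φ
  have hc := (Real.cosh_pos t).ne'
  have hip : ∀ a₀ a₁ a₂ c₀ c₁ c₂ : ℝ, inner ℝ (a₀ • b 0 + a₁ • b 1 + a₂ • b 2)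
      (c₀ • b 0 + c₁ • b 1 + c₂ • b 2) = a₀ * c₀ + a₁ * c₁ + a₂ * c₂ := by
    intro a₀ a₁ a₂ c₀ c₁ c₂
    simp [inner_add_left, inner_add_right, inner_smul_left, inner_smul_right, b.inner_eq_ite]
    ring
  have e0 : cylinderMap b t φ = (-Real.tanh t) • b 0 + ((Real.cosh t)⁻¹ * Real.sin φ) • b 1 +
      ((Real.cosh t)⁻¹ * Real.cos φ) • b 2 := by
    unfold cylinderMap; module
  have e1 : (-(Real.cosh t)⁻¹) • b 0 + (-Real.tanh t) • (Real.sin φ • b 1 + Real.cos φ • b 2) =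
      (-(Real.cosh t)⁻¹) • b 0 + (-Real.tanh t * Real.sin φ) • b 1 +
      (-Real.tanh t * Real.cos φ) • b 2 := by module
  have e2 : Real.cos φ • b 1 - Real.sin φ • b 2 =
      (0 : ℝ) • b 0 + Real.cos φ • b 1 + (-Real.sin φ) • b 2 := by module
  have hT : Real.tanh t ^ 2 + (Real.cosh t)⁻¹ ^ 2 = 1 := by
    rw [Real.tanh_eq_sinh_div_cosh]; field_simp; linarith
  rw [e0, e1, e2, orthonormal_iff_ite]
  intro i j
  fin_cases i <;> fin_cases j <;> refine (hip _ _ _ _ _ _).trans ?_ <;> norm_num [Fin.ext_iff]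
  · linear_combination hT + (Real.cosh t)⁻¹ ^ 2 * h2
  · linear_combination -(Real.cosh t)⁻¹ * Real.tanh t * h2
  · ring
  · linear_combination -(Real.cosh t)⁻¹ * Real.tanh t * h2
  · linear_combination hT + Real.tanh t ^ 2 * h2
  · ring
  · ring
  · ring
  · linear_combination h2

theorem norm_cylinderMap (b : OrthonormalBasis (Fin 3) ℝ E3) (t φ : ℝ) :
    ‖cylinderMap b t φ‖ = 1 := (orthonormal_cylinder_frame b t φ).1 0

/-- The point of the sphere with cylindrical coordinates `(t, φ)`. -/
def cylinderPoint (b : OrthonormalBasis (Fin 3) ℝ E3) (t φ : ℝ) : S2 :=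
  ⟨cylinderMap b t φ, by simp [norm_cylinderMap]⟩

/-- By the chain rule the Hessian terms give `cosh⁻² t` times the trace over the tangent frame, and
the missing radial entry is zero by homogeneity. The accelerations of the two coordinate curves sum
to a multiple of the position vector, which the gradient annihilates. -/
theorem hasLaplacianAt_cylinderPoint {v : S2 → ℝ} (b : OrthonormalBasis (Fin 3) ℝ E3) {t φ : ℝ}
    (hV : ContDiffAt ℝ 2 (homogExt v) (cylinderPoint b t φ : E3)) :
    HasLaplacianAt (fun t φ => v (cylinderPoint b t φ)) t φ
      ((Real.cosh t ^ 2)⁻¹ * sphereLaplacian v (cylinderPoint b t φ)) := by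
  set u : E3 := Real.sin φ • b 1 + Real.cos φ • b 2 with hu
  set D := fderiv ℝ (homogExt v) (cylinderMap b t φ) with hD
  set D2 := fderiv ℝ (fderiv ℝ (homogExt v)) (cylinderMap b t φ) with hD2
  have hV' : ContDiffAt ℝ 2 (homogExt v) (cylinderMap b t φ) := hV
  have hc := (Real.cosh_pos t).ne'
  have t1 : ∀ s, HasDerivAt (fun s => cylinderMap b s φ)
      ((-(Real.cosh s ^ 2)⁻¹) • b 0 + (-Real.sinh s / Real.cosh s ^ 2) • u) s := fun s =>
    ((hasDerivAt_neg_tanh s).smul_const (b 0)).add ((hasDerivAt_inv_cosh s).smul_const u)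
  have t2 := ((hasDerivAt_inv_cosh_sq t).neg.smul_const (b 0)).add
    ((hasDerivAt_sinh_div_cosh_sq t).smul_const u)
  have p1 : ∀ s, HasDerivAt (fun s => cylinderMap b t s)
      ((Real.cosh t)⁻¹ • (Real.cos s • b 1 + (-Real.sin s) • b 2)) s := fun s =>
    ((((Real.hasDerivAt_sin s).smul_const (b 1)).add
      ((Real.hasDerivAt_cos s).smul_const (b 2))).const_smul (Real.cosh t)⁻¹).const_add _
  have p2 := (((Real.hasDerivAt_cos φ).smul_const (b 1)).add
      ((Real.hasDerivAt_sin φ).neg.smul_const (b 2))).const_smul (Real.cosh t)⁻¹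
  have T := hasSecondDerivAt_comp_curve (γ := fun s => cylinderMap b s φ) (t := t) hV' t1 t2
  have P := hasSecondDerivAt_comp_curve (γ := fun s => cylinderMap b t s) (t := φ) hV' p1 p2
  have hfun : (fun t φ => v (cylinderPoint b t φ)) = fun t φ => homogExt v (cylinderMap b t φ) := by
    ext t φ
    exact (homogExt_coe v (cylinderPoint b t φ)).symm
  rw [hfun]
  refine ⟨_, _, T, P, ?_⟩
  have hfr := orthonormal_cylinder_frame b t φ
  set τ₁ : E3 := (-(Real.cosh t)⁻¹) • b 0 + (-Real.tanh t) • u with hτ₁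
  set τ₂ : E3 := Real.cos φ • b 1 - Real.sin φ • b 2 with hτ₂
  have hspan := hfr.linearIndependent.span_eq_top_of_card_eq_finrank' (by simp)
  have hlap : sphereLaplacian v (cylinderPoint b t φ) =
      D2 (cylinderMap b t φ) (cylinderMap b t φ) + D2 τ₁ τ₁ + D2 τ₂ τ₂ := by
    have h := congrFun (InnerProductSpace.laplacian_eq_iteratedFDeriv_orthonormalBasis (homogExt v)
      (OrthonormalBasis.mk hfr hspan.ge)) (cylinderMap b t φ)
    simp only [OrthonormalBasis.coe_mk, iteratedFDeriv_two_apply, Fin.sum_univ_three] at h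
    exact h
  obtain ⟨hD0, hD20⟩ := fderiv_homogExt_self hV'
  have hcs := Real.cosh_sq t
  have e1 : (-(Real.cosh t ^ 2)⁻¹) • b 0 + (-Real.sinh t / Real.cosh t ^ 2) • u =
      (Real.cosh t)⁻¹ • τ₁ := by
    have a1 : -(Real.cosh t ^ 2)⁻¹ = (Real.cosh t)⁻¹ * -(Real.cosh t)⁻¹ := by field_simp
    have a2 : -Real.sinh t / Real.cosh t ^ 2 = (Real.cosh t)⁻¹ * -Real.tanh t := by
      rw [Real.tanh_eq_sinh_div_cosh]; field_simp
    rw [a1, a2, hτ₁]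
    module
  have e2 : Real.cos φ • b 1 + (-Real.sin φ) • b 2 = τ₂ := by rw [hτ₂]; module
  have e3 : (-(-(2 * Real.sinh t) / Real.cosh t ^ 3)) • b 0 +
      (-(Real.cosh t)⁻¹ + 2 * Real.sinh t ^ 2 / Real.cosh t ^ 3) • u +
      (Real.cosh t)⁻¹ • ((-Real.sin φ) • b 1 + (-Real.cos φ) • b 2) =
      (-(2 * (Real.cosh t ^ 2)⁻¹)) • cylinderMap b t φ := by
    have e4 : (-Real.sin φ) • b 1 + (-Real.cos φ) • b 2 = -u := by rw [hu]; module
    have a1 : -(-(2 * Real.sinh t) / Real.cosh t ^ 3) =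
        -(2 * (Real.cosh t ^ 2)⁻¹) * -Real.tanh t := by
      rw [Real.tanh_eq_sinh_div_cosh]; field_simp
    have a2 : -(Real.cosh t)⁻¹ + 2 * Real.sinh t ^ 2 / Real.cosh t ^ 3 =
        -(2 * (Real.cosh t ^ 2)⁻¹) * (Real.cosh t)⁻¹ + (Real.cosh t)⁻¹ := by
      field_simp
      linarith
    have hcm : cylinderMap b t φ = (-Real.tanh t) • b 0 + (Real.cosh t)⁻¹ • u := rfl
    rw [e4, hcm, a1, a2]
    module
  have e5 : D ((-(-(2 * Real.sinh t) / Real.cosh t ^ 3)) • b 0 +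
      (-(Real.cosh t)⁻¹ + 2 * Real.sinh t ^ 2 / Real.cosh t ^ 3) • u) +
      D ((Real.cosh t)⁻¹ • ((-Real.sin φ) • b 1 + (-Real.cos φ) • b 2)) = 0 := by
    rw [← map_add, e3, map_smul, hD0, smul_zero]
  rw [hlap, hD20, e1, e2]
  simp only [map_smul, smul_apply, smul_eq_mul]
  simp only [map_smul, smul_eq_mul] at e5
  linear_combination e5

/-! ### Heights and rotational symmetry -/

theorem coe_north : ((north : S2) : E3) = EuclideanSpace.single 2 1 := rfl

theorem coe_south : ((south : S2) : E3) = -(north : E3) := rfl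

theorem height_eq_inner (θ : S2) : height θ = inner ℝ (north : E3) (θ : E3) := by
  simp [height, coe_north, EuclideanSpace.inner_single_left]

theorem norm_north : ‖(north : E3)‖ = 1 := by simp [coe_north]

theorem norm_sub_north_sq (θ : S2) : ‖(θ : E3) - north‖ ^ 2 = 2 - 2 * height θ := by
  rw [@norm_sub_sq_real, real_inner_comm, ← height_eq_inner, norm_north, norm_eq_of_mem_sphere]
  ring

theorem norm_sub_south_sq (θ : S2) : ‖(θ : E3) - south‖ ^ 2 = 2 + 2 * height θ := by
  rw [coe_south, sub_neg_eq_add, @norm_add_sq_real, real_inner_comm, ← height_eq_inner, norm_north,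
    norm_eq_of_mem_sphere]
  ring

theorem height_sq_le_one (θ : S2) : height θ ^ 2 ≤ 1 := by
  nlinarith [norm_sub_north_sq θ, norm_sub_south_sq θ, sq_nonneg ‖(θ : E3) - north‖,
    sq_nonneg ‖(θ : E3) - south‖]

theorem height_north : height north = 1 := by
  have := norm_sub_north_sq north
  rw [sub_self, norm_zero] at this
  linarith

theorem height_south : height south = -1 := by
  have := norm_sub_south_sq south
  rw [sub_self, norm_zero] at this
  linarith

theorem mem_puncturedSphere_iff (θ : S2) : θ ∈ puncturedSphere ↔ height θ ^ 2 < 1 := by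
  constructor
  · intro h
    refine lt_of_le_of_ne (height_sq_le_one θ) fun e => h ?_
    rcases mul_self_eq_one_iff.1 ((sq _).symm.trans e) with h1 | h1
    · left
      have := norm_sub_north_sq θ
      rw [h1] at this
      have h0 : ‖(θ : E3) - north‖ ^ 2 = 0 := by linarith
      exact Subtype.ext (sub_eq_zero.1 (norm_eq_zero.1 (pow_eq_zero_iff two_ne_zero |>.1 h0)))
    · right
      have := norm_sub_south_sq θ
      rw [h1] at this
      have h0 : ‖(θ : E3) - south‖ ^ 2 = 0 := by linarith
      exact Subtype.ext (sub_eq_zero.1 (norm_eq_zero.1 (pow_eq_zero_iff two_ne_zero |>.1 h0)))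
  · rintro h (rfl | rfl)
    · rw [height_north] at h; norm_num at h
    · rw [height_south] at h; norm_num at h

theorem height_eq_of_isometry {R : E3 ≃ₗᵢ[ℝ] E3} (hR : R (north : E3) = (north : E3)) {θ θ' : S2}
    (h : (θ' : E3) = R (θ : E3)) : height θ' = height θ := by
  rw [height_eq_inner, height_eq_inner, h]
  nth_rewrite 1 [← hR]
  exact R.inner_map_map _ _

/-- The reflection exchanging `θ` and `θ'` fixes the north pole when their heights agree. -/
theorem RotSymm.eq_of_height_eq {h : S2 → ℝ} (hs : RotSymm h) {θ θ' : S2}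
    (hθ : θ ∈ puncturedSphere) (e : height θ' = height θ) : h θ' = h θ := by
  set S := (Submodule.span ℝ {(θ : E3) - (θ' : E3)})ᗮ with hS
  refine hs S.reflection ?_ θ hθ θ' ?_
  · refine Submodule.reflection_mem_subspace_eq_self ?_
    rw [hS, Submodule.mem_orthogonal_singleton_iff_inner_left, inner_sub_right, ← height_eq_inner,
      ← height_eq_inner, e, sub_self]
  · exact (Submodule.reflection_sub (by simp)).symm

theorem rotSymm_of_height {h : S2 → ℝ}
    (H : ∀ θ ∈ puncturedSphere, ∀ θ' ∈ puncturedSphere, height θ' = height θ → h θ ≤ h θ') :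
    RotSymm h := by
  intro R hR θ hθ θ' e
  have hh := height_eq_of_isometry hR e
  have hθ' : θ' ∈ puncturedSphere := by
    rw [mem_puncturedSphere_iff] at hθ ⊢
    rwa [hh]
  exact le_antisymm (H θ' hθ' θ hθ hh.symm) (H θ hθ θ' hθ' hh)

theorem exists_onSamePolarGeodesic (θ : S2) (hθ : θ ∈ puncturedSphere) {y : ℝ} (hy : y ^ 2 < 1) :
    ∃ θ' ∈ puncturedSphere, height θ' = y ∧ OnSamePolarGeodesic θ θ' := by
  rw [mem_puncturedSphere_iff] at hθ
  set x := height θ with hx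
  have hx' : inner ℝ (north : E3) (θ : E3) = x := (height_eq_inner θ).symm
  have hnn : inner ℝ (north : E3) (north : E3) = (1 : ℝ) := by
    rw [real_inner_self_eq_norm_sq, norm_north]; norm_num
  have hθθ : inner ℝ (θ : E3) (θ : E3) = (1 : ℝ) := by
    rw [real_inner_self_eq_norm_sq, norm_eq_of_mem_sphere]; norm_num
  have hs : 0 < Real.sqrt (1 - x ^ 2) := Real.sqrt_pos.2 (by linarith)
  have hs2 : Real.sqrt (1 - x ^ 2) ^ 2 = 1 - x ^ 2 := Real.sq_sqrt (by linarith)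
  set s := Real.sqrt (1 - x ^ 2) with hsdef
  set u : E3 := s⁻¹ • ((θ : E3) - x • (north : E3)) with hu
  have hun : inner ℝ u (north : E3) = (0 : ℝ) := by
    rw [hu, inner_smul_left, inner_sub_left, inner_smul_left, hnn, real_inner_comm, hx']
    simp
  have huu : ‖u‖ = 1 := by
    have h1 : ‖u‖ ^ 2 = 1 := by
      rw [← real_inner_self_eq_norm_sq, hu]
      simp only [inner_smul_left, inner_smul_right, inner_sub_left, inner_sub_right, hnn, hx', hθθ,
        real_inner_comm (north : E3) (θ : E3)]
      simp
      field_simp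
      linarith
    nlinarith [norm_nonneg u]
  have hgeo : ∀ z : ℝ, z ^ 2 ≤ 1 → ∃ t : ℝ, z • (north : E3) + Real.sqrt (1 - z ^ 2) • u =
      Real.cos t • (north : E3) + Real.sin t • u := by
    intro z hz
    refine ⟨Real.arccos z, ?_⟩
    have := abs_le.1 ((sq_le_one_iff_abs_le_one z).1 hz)
    rw [Real.cos_arccos this.1 this.2, Real.sin_arccos]
  have hnorm : ∀ t : ℝ, ‖Real.cos t • (north : E3) + Real.sin t • u‖ = 1 := by
    intro t
    have h1 : ‖Real.cos t • (north : E3) + Real.sin t • u‖ ^ 2 = 1 := by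
      rw [@norm_add_sq_real, norm_smul, norm_smul, norm_north, huu, inner_smul_left,
        inner_smul_right, real_inner_comm, hun]
      simp
    nlinarith [norm_nonneg (Real.cos t • (north : E3) + Real.sin t • u)]
  obtain ⟨t, ht⟩ := hgeo y hy.le
  obtain ⟨t', ht'⟩ := hgeo x hθ.le
  set θ' : S2 := ⟨Real.cos t • (north : E3) + Real.sin t • u, by simp [hnorm]⟩ with hθ'
  have hh : height θ' = y := by
    rw [height_eq_inner]
    show inner ℝ (north : E3) (Real.cos t • (north : E3) + Real.sin t • u) = y
    rw [← ht, inner_add_right, inner_smul_right, inner_smul_right, hnn, real_inner_comm, hun]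
    simp
  refine ⟨θ', ?_, hh, u, huu, hun, ⟨t', ?_⟩, t, rfl⟩
  · rw [mem_puncturedSphere_iff, hh]; exact hy
  · rw [← ht', ← hsdef, hu, smul_smul, mul_inv_cancel₀ hs.ne']
    module

/-- A rotationally symmetric function that grows towards the poles is a monotone function of the
height on each hemisphere. -/
theorem MonotoneTowardsPoles.le_of_height {h : S2 → ℝ} (hm : MonotoneTowardsPoles h)
    (hs : RotSymm h) {θ θ' : S2} (hθ : θ ∈ puncturedSphere) (hθ' : θ' ∈ puncturedSphere)
    (hle : |height θ'| ≤ |height θ|) (hsign : 0 ≤ height θ * height θ') : h θ' ≤ h θ := by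
  by_cases e : height θ' = height θ
  · exact (hs.eq_of_height_eq hθ e).le
  -- Symmetry allows `θ'` to be replaced by a point of the same height on a polar geodesic through
  -- `θ`.
  obtain ⟨σ, hσ, hσh, hσg⟩ :=
    exists_onSamePolarGeodesic θ hθ ((mem_puncturedSphere_iff θ').1 hθ')
  rw [hs.eq_of_height_eq hσ hσh.symm]
  obtain ⟨h1, h2⟩ := hm θ hθ σ hσ hσg
  rw [hσh] at h1 h2
  rcases lt_or_gt_of_ne e with hlt | hgt
  · refine h1 hlt ?_
    by_contra! hneg
    have := nonpos_of_mul_nonneg_left hsign hneg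
    rw [abs_of_neg hneg, abs_of_nonpos this] at hle
    linarith
  · refine h2 hgt ?_
    by_contra! hpos
    have := nonneg_of_mul_nonneg_left hsign hpos
    rw [abs_of_pos hpos, abs_of_nonneg this] at hle
    linarith

/-! ### Cylindrical coordinates with horizontal axis -/

section Cylinder

variable {b : OrthonormalBasis (Fin 3) ℝ E3}

theorem inner_zero_cylinderPoint (b : OrthonormalBasis (Fin 3) ℝ E3) (t φ : ℝ) :
    inner ℝ (b 0) (cylinderPoint b t φ : E3) = -Real.tanh t := by
  show inner ℝ (b 0) (cylinderMap b t φ) = -Real.tanh t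
  simp [cylinderMap, inner_add_right, inner_smul_right, b.inner_eq_ite]

theorem height_cylinderPoint (hb : b 2 = (north : E3)) (t φ : ℝ) :
    height (cylinderPoint b t φ) = Real.cos φ / Real.cosh t := by
  rw [height_eq_inner, ← hb]
  show inner ℝ (b 2) (cylinderMap b t φ) = _
  simp [cylinderMap, inner_add_right, inner_smul_right, b.inner_eq_ite]
  ring

theorem one_sub_height_cylinderPoint_sq (hb : b 2 = (north : E3)) (t φ : ℝ) :
    1 - height (cylinderPoint b t φ) ^ 2 = poleFun t φ / Real.cosh t ^ 2 := by
  have hc := (Real.cosh_pos t).ne'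
  have h1 := Real.cosh_sq t
  have h2 := Real.sin_sq_add_cos_sq φ
  rw [height_cylinderPoint hb, poleFun]
  field_simp
  linarith

theorem cylinderPoint_mem_iff (hb : b 2 = (north : E3)) (t φ : ℝ) :
    cylinderPoint b t φ ∈ puncturedSphere ↔ poleFun t φ ≠ 0 := by
  have hc := pow_pos (Real.cosh_pos t) 2
  have h := one_sub_height_cylinderPoint_sq hb t φ
  rw [mem_puncturedSphere_iff, ← sub_pos, h]
  constructor
  · rintro h1 h2
    rw [h2] at h1; simp at h1
  · intro h1
    exact div_pos (poleFun_pos h1) hc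

theorem continuous_cylinderPoint (b : OrthonormalBasis (Fin 3) ℝ E3) :
    Continuous fun p : ℝ × ℝ => cylinderPoint b p.1 p.2 := by
  refine Continuous.subtype_mk ?_ _
  have h1 : Continuous fun t : ℝ => -Real.tanh t :=
    continuous_iff_continuousAt.2 fun t => (hasDerivAt_neg_tanh t).continuousAt
  have h2 : Continuous fun t : ℝ => (Real.cosh t)⁻¹ :=
    continuous_iff_continuousAt.2 fun t => (hasDerivAt_inv_cosh t).continuousAt
  exact ((h1.comp continuous_fst).smul continuous_const).add
    ((h2.comp continuous_fst).smul (by fun_prop))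

theorem cylinderPoint_add_two_pi (b : OrthonormalBasis (Fin 3) ℝ E3) (t φ : ℝ) :
    cylinderPoint b t (φ + 2 * Real.pi) = cylinderPoint b t φ := by
  simp [cylinderPoint, cylinderMap]

/-- The pair of closed caps `|t| ≥ |T|` around the ends of the cylinder. -/
def endCaps (b : OrthonormalBasis (Fin 3) ℝ E3) (T : ℝ) : Set S2 :=
  {θ | 1 - (Real.cosh T ^ 2)⁻¹ ≤ inner ℝ (b 0) (θ : E3) ^ 2}

theorem isCompact_endCaps (b : OrthonormalBasis (Fin 3) ℝ E3) (T : ℝ) :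
    IsCompact (endCaps b T) := by
  refine IsClosed.isCompact ?_
  exact isClosed_le continuous_const
    ((continuous_const.inner continuous_subtype_val).pow 2)

/-- The poles are orthogonal to `b 0`, whereas `T ≠ 0` makes the threshold positive. The caps are
thus compact sets on which `K` and `v` are bounded and uniformly continuous. -/
theorem endCaps_subset (hb : b 2 = (north : E3)) {T : ℝ} (hT : T ≠ 0) :
    endCaps b T ⊆ puncturedSphere := by
  have h1 : 1 < Real.cosh T ^ 2 := one_lt_pow₀ (Real.one_lt_cosh.2 hT) two_ne_zero
  have h2 : (Real.cosh T ^ 2)⁻¹ < 1 := inv_lt_one_of_one_lt₀ h1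
  have h3 : inner ℝ (b 0) (north : E3) = (0 : ℝ) := by rw [← hb]; simp [b.inner_eq_ite]
  rintro θ hθ (rfl | rfl)
  · have : 1 - (Real.cosh T ^ 2)⁻¹ ≤ inner ℝ (b 0) ((north : S2) : E3) ^ 2 := hθ
    rw [h3] at this
    linarith
  · have : 1 - (Real.cosh T ^ 2)⁻¹ ≤ inner ℝ (b 0) ((south : S2) : E3) ^ 2 := hθ
    rw [coe_south, inner_neg_right, h3] at this
    linarith

theorem cylinderPoint_mem_endCaps (b : OrthonormalBasis (Fin 3) ℝ E3) {t T : ℝ} (h : |T| ≤ |t|)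
    (φ : ℝ) : cylinderPoint b t φ ∈ endCaps b T := by
  show 1 - (Real.cosh T ^ 2)⁻¹ ≤ inner ℝ (b 0) (cylinderPoint b t φ : E3) ^ 2
  have h1 : Real.cosh T ^ 2 ≤ Real.cosh t ^ 2 :=
    pow_le_pow_left₀ (Real.cosh_pos T).le (Real.cosh_le_cosh.2 h) 2
  have h2 := inv_anti₀ (pow_pos (Real.cosh_pos T) 2) h1
  have h3 : Real.tanh t ^ 2 = 1 - (Real.cosh t ^ 2)⁻¹ := by
    have := Real.cosh_sq t
    have := (Real.cosh_pos t).ne'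
    rw [Real.tanh_eq_sinh_div_cosh]
    field_simp
    linarith
  rw [inner_zero_cylinderPoint, neg_sq, h3]
  linarith

theorem abs_sub_le_of_abs_deriv_le_one {g g' : ℝ → ℝ} (hg : ∀ x, HasDerivAt g (g' x) x)
    (hg' : ∀ x, |g' x| ≤ 1) (x y : ℝ) : |g x - g y| ≤ |x - y| := by
  have := Convex.norm_image_sub_le_of_norm_hasDerivWithin_le (f := g) (f' := g') (C := 1)
    (s := Set.univ) (x := y) (y := x) (fun x _ => (hg x).hasDerivWithinAt)
    (fun x _ => by simpa using hg' x) convex_univ trivial trivial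
  simpa using this

theorem hasDerivAt_log_cosh (t : ℝ) :
    HasDerivAt (fun s => Real.log (Real.cosh s)) (Real.tanh t) t := by
  rw [Real.tanh_eq_sinh_div_cosh]
  exact (Real.hasDerivAt_cosh t).log (Real.cosh_pos t).ne'

theorem hasSecondDerivAt_log_cosh (t : ℝ) :
    HasSecondDerivAt (fun s => Real.log (Real.cosh s)) (Real.cosh t ^ 2)⁻¹ t := by
  refine ⟨Real.tanh, Eventually.of_forall hasDerivAt_log_cosh, ?_⟩
  simpa using (hasDerivAt_neg_tanh t).fun_neg

theorem dist_cylinderPoint_le (b : OrthonormalBasis (Fin 3) ℝ E3) (s t φ : ℝ) :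
    dist (cylinderPoint b s φ) (cylinderPoint b t φ) ≤ 2 * |s - t| := by
  have h1 : |(-Real.tanh s) - (-Real.tanh t)| ≤ |s - t| :=
    abs_sub_le_of_abs_deriv_le_one hasDerivAt_neg_tanh (fun x => by
      rw [abs_neg, abs_of_nonneg (by positivity)]
      exact inv_le_one_of_one_le₀ (one_le_pow₀ (Real.one_le_cosh x))) s t
  have h2 : |(Real.cosh s)⁻¹ - (Real.cosh t)⁻¹| ≤ |s - t| :=
    abs_sub_le_of_abs_deriv_le_one hasDerivAt_inv_cosh (fun x => by
      have hc := Real.cosh_pos x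
      rw [abs_div, abs_neg, abs_of_nonneg (by positivity : 0 ≤ Real.cosh x ^ 2),
        div_le_one (by positivity)]
      refine abs_le_of_sq_le_sq ?_ (by positivity)
      have := Real.cosh_sq x
      have := one_le_pow₀ (Real.one_le_cosh x) (n := 2)
      nlinarith) s t
  have hu : ‖Real.sin φ • b 1 + Real.cos φ • b 2‖ = 1 := by
    have : ‖Real.sin φ • b 1 + Real.cos φ • b 2‖ ^ 2 = 1 := by
      rw [@norm_add_sq_real, norm_smul, norm_smul, inner_smul_left, inner_smul_right]
      simp [b.inner_eq_ite]
    nlinarith [norm_nonneg (Real.sin φ • b 1 + Real.cos φ • b 2)]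
  have e : cylinderMap b s φ - cylinderMap b t φ = ((-Real.tanh s) - (-Real.tanh t)) • b 0 +
      ((Real.cosh s)⁻¹ - (Real.cosh t)⁻¹) • (Real.sin φ • b 1 + Real.cos φ • b 2) := by
    unfold cylinderMap; module
  rw [Subtype.dist_eq, dist_eq_norm]
  show ‖cylinderMap b s φ - cylinderMap b t φ‖ ≤ _
  rw [e]
  refine (norm_add_le _ _).trans ?_
  rw [norm_smul, norm_smul, hu, b.norm_eq_one, Real.norm_eq_abs, Real.norm_eq_abs]
  linarith

end Cylinder

/-! ### Solutions on the punctured sphere -/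

/-- Classical solutions of `-Δv + 1 = K e^{2v} + f` on the punctured sphere whose data are
rotationally symmetric and increase towards the poles, with the lower bounds for `v` at the poles. -/
structure SphereSolution (K f v : S2 → ℝ) : Prop where
  K_cont : ContinuousOn K puncturedSphere
  K_nonneg : ∀ θ ∈ puncturedSphere, 0 ≤ K θ
  f_nonneg : ∀ θ ∈ puncturedSphere, 0 ≤ f θ
  K_mono : MonotoneTowardsPoles K
  f_mono : MonotoneTowardsPoles f
  nontrivial : ∃ θ ∈ puncturedSphere, (f θ) ^ 2 + (K θ - ⨍ σ, K σ ∂surfaceMeasure) ^ 2 ≠ 0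
  K_symm : RotSymm K
  f_symm : RotSymm f
  contMDiffOn : ContMDiffOn (𝓡 2) 𝓘(ℝ, ℝ) 2 v puncturedSphere
  equation : ∀ θ ∈ puncturedSphere, -sphereLaplacian v θ + 1 = K θ * Real.exp (2 * v θ) + f θ
  north : limsup (fun θ : S2 => ((v θ / Real.log (geodDist θ north) : ℝ) : EReal)) (𝓝[≠] north) ≤ 0
  south : limsup (fun θ : S2 => ((v θ / Real.log (geodDist θ south) : ℝ) : EReal)) (𝓝[≠] south) ≤ 0

theorem cos_geodDist (θ σ : S2) : Real.cos (geodDist θ σ) = inner ℝ (θ : E3) (σ : E3) := by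
  rw [geodDist, InnerProductGeometry.cos_angle]
  simp

/-- The lower bound at one of the poles. -/
theorem exists_log_le_of_limsup {v : S2 → ℝ} {p : S2} 
    (hp : ∀ θ : S2, inner ℝ (θ : E3) (p : E3) ^ 2 = height θ ^ 2)
    (h : limsup (fun θ : S2 => ((v θ / Real.log (geodDist θ p) : ℝ) : EReal)) (𝓝[≠] p) ≤ 0)
    {ε : ℝ} (hε : 0 < ε) : ∃ ρ > 0, ∀ θ ∈ puncturedSphere, dist θ p < ρ →
      ε * Real.log (1 - height θ ^ 2) ≤ v θ := by
  have h1 : ∀ᶠ θ in 𝓝[≠] p, ((v θ / Real.log (geodDist θ p) : ℝ) : EReal) < ((2 * ε : ℝ) : EReal) :=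
    eventually_lt_of_limsup_lt (h.trans_lt (by exact_mod_cast (by positivity : (0 : ℝ) < 2 * ε)))
  have hpp : inner ℝ (p : E3) (p : E3) = (1 : ℝ) := by
    rw [real_inner_self_eq_norm_sq, norm_eq_of_mem_sphere]; norm_num
  have hc : ContinuousAt (fun θ : S2 => inner ℝ (θ : E3) (p : E3)) p := by fun_prop
  have h2 : ∀ᶠ θ : S2 in 𝓝 p, Real.cos 1 < inner ℝ (θ : E3) (p : E3) :=
    hc.eventually (lt_mem_nhds (by simp only [hpp]; linarith [Real.cos_one_le]))
  rw [eventually_nhdsWithin_iff] at h1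
  obtain ⟨ρ, hρ, H⟩ := Metric.eventually_nhds_iff.1 (h1.and h2)
  refine ⟨ρ, hρ, fun θ hθ hd => ?_⟩
  obtain ⟨H1, H2⟩ := H hd
  have hθ1 := (mem_puncturedSphere_iff θ).1 hθ
  have hne : θ ≠ p := by
    rintro rfl
    have := hp θ
    rw [hpp] at this
    linarith
  have H3 : v θ / Real.log (geodDist θ p) < 2 * ε := by exact_mod_cast H1 hne
  set d := geodDist θ p with hdef
  have hcos : Real.cos d = inner ℝ (θ : E3) (p : E3) := cos_geodDist θ p
  have hd0 : 0 ≤ d := InnerProductGeometry.angle_nonneg _ _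
  have hdpi : d ≤ Real.pi := InnerProductGeometry.angle_le_pi _ _
  have hsin : Real.sin d ^ 2 = 1 - height θ ^ 2 := by rw [Real.sin_sq, hcos, hp]
  have hdpos : 0 < d := by
    refine lt_of_le_of_ne hd0 fun e => ?_
    rw [← e, Real.sin_zero] at hsin
    linarith
  have hd1 : d < 1 := by
    by_contra! hge
    have := Real.cos_le_cos_of_nonneg_of_le_pi zero_le_one hdpi hge
    rw [hcos] at this
    linarith
  have hlog : Real.log d < 0 := Real.log_neg hdpos hd1
  -- The logarithm is negative, so the inequality becomes `v > 2ε log d`; the factor 2 is absorbed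
  -- by `1 - height² = sin² d ≤ d²`.
  rw [div_lt_iff_of_neg hlog] at H3
  have hle : Real.log (1 - height θ ^ 2) ≤ 2 * Real.log d := by
    have h5 : Real.log (d ^ 2) = 2 * Real.log d := by rw [Real.log_pow]; norm_num
    rw [← h5]
    refine Real.log_le_log (by linarith) ?_
    rw [← hsin]
    exact pow_le_pow_left₀ (Real.sin_nonneg_of_nonneg_of_le_pi hd0 hdpi) (Real.sin_le hd0) 2
  have := mul_le_mul_of_nonneg_left hle hε.le
  linarith

namespace SphereSolution

variable {K f v : S2 → ℝ}

theorem exists_log_le (h : SphereSolution K f v) {ε : ℝ} (hε : 0 < ε) :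
    ∃ ρ > 0, ∀ θ ∈ puncturedSphere, 1 - height θ ^ 2 < ρ →
      ε * Real.log (1 - height θ ^ 2) ≤ v θ := by
  obtain ⟨r, hr, H⟩ := exists_log_le_of_limsup (p := SphereEq.north) (fun θ => by
    rw [real_inner_comm, ← height_eq_inner]) h.north hε
  obtain ⟨r', hr', H'⟩ := exists_log_le_of_limsup (p := SphereEq.south) (fun θ => by
    rw [coe_south, inner_neg_right, neg_sq, real_inner_comm, ← height_eq_inner]) h.south hε
  have key : ∀ (θ p : S2) (s : ℝ), 0 < s → ‖(θ : E3) - p‖ ^ 2 < s ^ 2 → dist θ p < s := by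
    intro θ p s hs hlt
    rw [Subtype.dist_eq, dist_eq_norm]
    exact lt_of_pow_lt_pow_left₀ 2 hs.le hlt
  -- On the northern hemisphere the squared chord to the pole is `2 - 2 height ≤ 2 (1 - height²)`;
  -- likewise in the south.
  refine ⟨min (r ^ 2 / 2) (r' ^ 2 / 2), lt_min (by positivity) (by positivity), fun θ hθ hlt => ?_⟩
  have hl1 := hlt.trans_le (min_le_left _ _)
  have hl2 := hlt.trans_le (min_le_right _ _)
  have h1 := abs_le.1 ((sq_le_one_iff_abs_le_one _).1 (height_sq_le_one θ))
  rcases le_total 0 (height θ) with h0 | h0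
  · refine H θ hθ (key _ _ _ hr ?_)
    rw [norm_sub_north_sq]
    nlinarith
  · refine H' θ hθ (key _ _ _ hr' ?_)
    rw [norm_sub_south_sq]
    nlinarith

theorem continuousOn (h : SphereSolution K f v) : ContinuousOn v puncturedSphere :=
  h.contMDiffOn.continuousOn

/-- The monotonicity of the data in cylindrical coordinates. -/
theorem le_of_cylinder {g : S2 → ℝ} (hm : MonotoneTowardsPoles g) (hs : RotSymm g)
    {b : OrthonormalBasis (Fin 3) ℝ E3} (hb : b 2 = (SphereEq.north : E3)) {t y φ : ℝ} (hty : t < y)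
    (hyt : y < -t) (hp : poleFun y φ ≠ 0) : g (cylinderPoint b t φ) ≤ g (cylinderPoint b y φ) := by
  have ht : t < 0 := by linarith
  refine hm.le_of_height hs ((cylinderPoint_mem_iff hb _ _).2 hp)
    ((cylinderPoint_mem_iff hb _ _).2 (poleFun_ne_zero_of_ne ht.ne φ)) ?_ ?_
  · rw [height_cylinderPoint hb, height_cylinderPoint hb, abs_div, abs_div,
      abs_of_pos (Real.cosh_pos _), abs_of_pos (Real.cosh_pos _)]
    refine div_le_div_of_nonneg_left (abs_nonneg _) (Real.cosh_pos _) (Real.cosh_le_cosh.2 ?_)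
    rw [abs_of_neg ht, abs_le]
    constructor <;> linarith
  · rw [height_cylinderPoint hb, height_cylinderPoint hb, div_mul_div_comm]
    have := Real.cosh_pos t
    have := Real.cosh_pos y
    exact div_nonneg (mul_self_nonneg _) (by positivity)

/-! ### The nontriviality condition and the equation in cylindrical coordinates. -/

theorem ae_mem_puncturedSphere : ∀ᵐ θ ∂surfaceMeasure, θ ∈ puncturedSphere := by
  have hsing : ∀ p : S2, surfaceMeasure {p} = 0 := by
    intro p
    rw [surfaceMeasure, Measure.toSphere_apply' _ (MeasurableSet.singleton p)]
    refine mul_eq_zero_of_right _ (measure_mono_null ?_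
      (Measure.addHaar_submodule volume (Submodule.span ℝ {(p : E3)}) ?_))
    · rintro _ ⟨r, -, _, ⟨q, hq, rfl⟩, rfl⟩
      obtain rfl : q = p := hq
      exact Submodule.smul_mem _ _ (Submodule.mem_span_singleton_self _)
    · intro e
      have h1 := finrank_span_singleton (K := ℝ) (ne_zero_of_mem_unit_sphere p)
      rw [e, finrank_top] at h1
      simp at h1
  have : surfaceMeasure ({SphereEq.north, SphereEq.south} : Set S2) = 0 := by
    rw [Set.insert_eq]
    exact measure_union_null (hsing _) (hsing _)
  rw [ae_iff]
  convert this using 2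
  ext θ
  exact not_not

/-- The poles are null, so a constant `K` equals its mean. If `K` is not integrable, the average is
`0` by convention while `K` is not identically zero, so the condition holds automatically, as
intended. -/
theorem not_constant (h : SphereSolution K f v) {κ : ℝ} (hf : ∀ θ ∈ puncturedSphere, f θ = 0)
    (hK : ∀ θ ∈ puncturedSphere, K θ = κ) : False := by
  obtain ⟨θ, hθ, hne⟩ := h.nontrivial
  have hav : ⨍ σ, K σ ∂surfaceMeasure = κ := by
    have hae : K =ᵐ[surfaceMeasure] fun _ => κ := by
      filter_upwards [ae_mem_puncturedSphere] with σ hσ using hK σ hσ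
    have : IsFiniteMeasure surfaceMeasure := by unfold surfaceMeasure; infer_instance
    have : NeZero surfaceMeasure := ⟨Measure.toSphere_ne_zero _⟩
    rw [average_congr hae, average_const]
  rw [hav, hf θ hθ, hK θ hθ] at hne
  simp at hne

/-- The solution in cylindrical coordinates. -/
def toCylinder (v : S2 → ℝ) (b : OrthonormalBasis (Fin 3) ℝ E3) (t φ : ℝ) : ℝ :=
  v (cylinderPoint b t φ) - Real.log (Real.cosh t)

theorem exp_toCylinder (v : S2 → ℝ) (b : OrthonormalBasis (Fin 3) ℝ E3) (t φ : ℝ) :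
    Real.exp (2 * toCylinder v b t φ) =
      Real.exp (2 * v (cylinderPoint b t φ)) / Real.cosh t ^ 2 := by
  rw [toCylinder, mul_sub, Real.exp_sub]
  congr 1
  rw [mul_comm, Real.exp_mul, Real.exp_log (Real.cosh_pos t)]
  norm_cast

theorem continuousOn_toCylinder (h : SphereSolution K f v) {b : OrthonormalBasis (Fin 3) ℝ E3}
    (hb : b 2 = (SphereEq.north : E3)) :
    ContinuousOn (fun p : ℝ × ℝ => toCylinder v b p.1 p.2) {p | poleFun p.1 p.2 ≠ 0} := by
  refine ContinuousOn.sub (h.continuousOn.comp (continuous_cylinderPoint b).continuousOn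
    fun p hp => (cylinderPoint_mem_iff hb _ _).2 hp) ?_
  have : Continuous fun t : ℝ => Real.log (Real.cosh t) :=
    Real.continuous_cosh.log fun t => (Real.cosh_pos t).ne'
  exact (this.comp continuous_fst).continuousOn

theorem hasLaplacianAt_toCylinder (h : SphereSolution K f v) {b : OrthonormalBasis (Fin 3) ℝ E3}
    (hb : b 2 = (SphereEq.north : E3)) {t φ : ℝ} (hp : poleFun t φ ≠ 0) :
    HasLaplacianAt (toCylinder v b) t φ
      (-(K (cylinderPoint b t φ) * Real.exp (2 * toCylinder v b t φ) +
        f (cylinderPoint b t φ) / Real.cosh t ^ 2)) := by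
  have hm := (cylinderPoint_mem_iff hb t φ).2 hp
  have h1 := (hasLaplacianAt_cylinderPoint b (contDiffAt_homogExt h.contMDiffOn hm)).sub
    ((hasSecondDerivAt_log_cosh t).hasLaplacianAt_fst φ)
  have h2 := h.equation _ hm
  refine (congrArg (HasLaplacianAt (toCylinder v b) t φ) ?_).mp h1
  rw [exp_toCylinder, show sphereLaplacian v (cylinderPoint b t φ) =
    1 - (K (cylinderPoint b t φ) * Real.exp (2 * v (cylinderPoint b t φ)) +
      f (cylinderPoint b t φ)) by linarith]
  ring

theorem eq_zero_of_hasLaplacianAt {u : ℝ → ℝ → ℝ} {t φ L : ℝ} (hu : HasLaplacianAt u t φ L)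
    (h : ∀ᶠ p in 𝓝 (t, φ), u p.1 p.2 = 0) : L = 0 := by
  have h0 : u t φ = 0 := h.self_of_nhds
  refine le_antisymm ?_ (hu.nonneg_of_isLocalMin ?_)
  · have := (hu.const_mul (-1)).nonneg_of_isLocalMin (by
      filter_upwards [h] with p hp
      rw [hp, h0])
    linarith
  · filter_upwards [h] with p hp
    rw [hp, h0]

/-- If the reflected solution agrees with the solution, then so do the data. -/
theorem data_eq_of_reflection_eq (h : SphereSolution K f v) {b : OrthonormalBasis (Fin 3) ℝ E3}
    (hb : b 2 = (SphereEq.north : E3)) {τ : ℝ} (hτ : τ < 0)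
    (heq : ∀ t < τ, ∀ φ, poleFun (t - 2 * τ) φ ≠ 0 →
      toCylinder v b (2 * τ - t) φ = toCylinder v b t φ)
    {t φ : ℝ} (ht : t < τ) (hp : poleFun (t - 2 * τ) φ ≠ 0) :
    K (cylinderPoint b (2 * τ - t) φ) = K (cylinderPoint b t φ) ∧
      f (cylinderPoint b (2 * τ - t) φ) = 0 := by
  have hp' : poleFun (2 * τ - t) φ ≠ 0 := by rwa [poleFun_sub_comm]
  have hpt : poleFun t φ ≠ 0 := poleFun_ne_zero_of_ne (by linarith) φ
  have hlap := ((h.hasLaplacianAt_toCylinder hb hp').comp_const_sub (2 * τ)).sub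
    (h.hasLaplacianAt_toCylinder hb hpt)
  have hcontS : Continuous fun p : ℝ × ℝ => poleFun (p.1 - 2 * τ) p.2 := by
    unfold poleFun; fun_prop
  have hL := eq_zero_of_hasLaplacianAt hlap (by
    have h1 : ∀ᶠ p : ℝ × ℝ in 𝓝 (t, φ), poleFun (p.1 - 2 * τ) p.2 ≠ 0 :=
      hcontS.continuousAt.eventually_ne hp
    have h2 : ∀ᶠ p : ℝ × ℝ in 𝓝 (t, φ), p.1 < τ :=
      continuous_fst.continuousAt.eventually (gt_mem_nhds ht)
    filter_upwards [h1, h2] with p hp1 hp2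
    rw [heq _ hp2 _ hp1, sub_self])
  -- `hL` now equates a sum of two nonnegative data increments to zero. Since `cosh y < cosh t`, the
  -- increment of `f / cosh²` is positive unless `f` vanishes at the reflected point.
  rw [heq t ht φ hp] at hL
  have hKle := le_of_cylinder h.K_mono h.K_symm hb (φ := φ) (show t < 2 * τ - t by linarith)
    (by linarith) hp'
  have hfle := le_of_cylinder h.f_mono h.f_symm hb (φ := φ) (show t < 2 * τ - t by linarith)
    (by linarith) hp'
  have hf0 := h.f_nonneg _ ((cylinderPoint_mem_iff hb _ _).2 hp')
  set E := Real.exp (2 * toCylinder v b t φ) with hE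
  have hE0 : 0 < E := Real.exp_pos _
  set y := 2 * τ - t with hy
  have hcosh : Real.cosh y < Real.cosh t := Real.cosh_lt_cosh.2 (by
    rw [abs_of_neg (by linarith : t < 0), abs_lt]; constructor <;> linarith)
  have hcy : 0 < Real.cosh y ^ 2 := pow_pos (Real.cosh_pos y) 2
  have hct : Real.cosh y ^ 2 < Real.cosh t ^ 2 :=
    pow_lt_pow_left₀ hcosh (Real.cosh_pos y).le two_ne_zero
  have h1 : K (cylinderPoint b t φ) * E ≤ K (cylinderPoint b y φ) * E :=
    mul_le_mul_of_nonneg_right hKle hE0.le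
  have h2 : f (cylinderPoint b t φ) / Real.cosh t ^ 2 ≤ f (cylinderPoint b y φ) / Real.cosh t ^ 2 :=
    div_le_div_of_nonneg_right hfle (hcy.trans hct).le
  have h3 : f (cylinderPoint b y φ) / Real.cosh t ^ 2 ≤ f (cylinderPoint b y φ) / Real.cosh y ^ 2 :=
    div_le_div_of_nonneg_left hf0 hcy hct.le
  constructor
  · have : K (cylinderPoint b y φ) * E = K (cylinderPoint b t φ) * E := by linarith
    exact mul_right_cancel₀ hE0.ne' this
  · by_contra hne
    have := div_lt_div_of_pos_left (lt_of_le_of_ne hf0 (Ne.symm hne)) hcy hct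
    linarith

theorem continuous_cylinderPoint_right (b : OrthonormalBasis (Fin 3) ℝ E3) (t : ℝ) :
    Continuous (cylinderPoint b t) :=
  (continuous_cylinderPoint b).comp (f := fun φ : ℝ => (t, φ)) (by fun_prop)

/-- Equality at `τ` identifies the circle `t = 0` with `t = 2τ`, where heights are divided by `q =
cosh 2τ > 1`. Iterating `K(x) = K(x / q)` drives the height to the equator, where `K` is continuous.
-/
theorem nondegenerate (h : SphereSolution K f v) {b : OrthonormalBasis (Fin 3) ℝ E3}
    (hb : b 2 = (SphereEq.north : E3)) {τ : ℝ} (hτ : τ < 0) :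
    ∃ t < τ, ∃ φ, poleFun (t - 2 * τ) φ ≠ 0 ∧
      toCylinder v b (2 * τ - t) φ ≠ toCylinder v b t φ := by
  by_contra! heq
  set q := Real.cosh (2 * τ) with hq
  have hq1 : 1 < q := Real.one_lt_cosh.2 (by linarith)
  set P : ℝ → S2 := fun x => cylinderPoint b 0 (Real.arccos x) with hP
  have hPh : ∀ x, x ^ 2 < 1 → height (P x) = x := by
    intro x hx
    have := abs_le.1 ((sq_le_one_iff_abs_le_one x).1 hx.le)
    rw [hP, height_cylinderPoint hb, Real.cos_arccos this.1 this.2]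
    simp
  have hPmem : ∀ x, x ^ 2 < 1 → P x ∈ puncturedSphere := by
    intro x hx
    rw [mem_puncturedSphere_iff, hPh x hx]
    exact hx
  have hpole : ∀ x : ℝ, x ^ 2 < 1 → poleFun (2 * τ - 2 * τ) (Real.arccos x) ≠ 0 := by
    intro x hx
    rw [sub_self]
    exact (cylinderPoint_mem_iff hb _ _).1 (hPmem x hx)
  have hstep : ∀ x, x ^ 2 < 1 → K (P x) = K (P (x / q)) ∧ f (P x) = 0 := by
    intro x hx
    have hxq : (x / q) ^ 2 < 1 := by
      rw [div_pow]
      exact (div_le_self (sq_nonneg x) (one_le_pow₀ hq1.le)).trans_lt hx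
    obtain ⟨h1, h2⟩ := h.data_eq_of_reflection_eq hb hτ heq (t := 2 * τ) (φ := Real.arccos x)
      (by linarith) (hpole x hx)
    rw [sub_self] at h1 h2
    refine ⟨?_, h2⟩
    rw [show K (P x) = K (cylinderPoint b (2 * τ) (Real.arccos x)) from h1]
    refine h.K_symm.eq_of_height_eq (hPmem _ hxq) ?_
    have := abs_le.1 ((sq_le_one_iff_abs_le_one x).1 hx.le)
    rw [hPh _ hxq, height_cylinderPoint hb, Real.cos_arccos this.1 this.2]
  have hqn : ∀ x, x ^ 2 < 1 → ∀ n : ℕ, (x / q ^ n) ^ 2 < 1 := by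
    intro x hx n
    rw [div_pow]
    exact (div_le_self (sq_nonneg x) (one_le_pow₀ (one_le_pow₀ hq1.le))).trans_lt hx
  have hiter : ∀ x, x ^ 2 < 1 → ∀ n : ℕ, K (P (x / q ^ n)) = K (P x) := by
    intro x hx n
    induction n with
    | zero => simp
    | succ n ih =>
      rw [← ih, (hstep _ (hqn x hx n)).1, pow_succ, div_div]
  have hPc : Continuous P := (continuous_cylinderPoint_right b 0).comp Real.continuous_arccos
  have hK0 : ∀ x, x ^ 2 < 1 → K (P x) = K (P 0) := by
    intro x hx
    have hlim : Tendsto (fun n : ℕ => x / q ^ n) atTop (𝓝 0) :=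
      tendsto_const_nhds.div_atTop (tendsto_pow_atTop_atTop_of_one_lt hq1)
    have hc : ContinuousAt (fun y => K (P y)) 0 :=
      ContinuousAt.comp (g := K) (f := P)
        (h.K_cont.continuousAt (isOpen_puncturedSphere.mem_nhds (hPmem 0 (by norm_num))))
        hPc.continuousAt
    have h1 := hc.tendsto.comp hlim
    refine tendsto_nhds_unique ?_ h1
    refine Tendsto.congr (fun n => (hiter x hx n).symm) tendsto_const_nhds
  refine h.not_constant (κ := K (P 0)) (fun θ hθ => ?_) fun θ hθ => ?_
  · have hx := (mem_puncturedSphere_iff θ).1 hθ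
    rw [h.f_symm.eq_of_height_eq (hPmem _ hx) (hPh _ hx).symm, (hstep _ hx).2]
  · have hx := (mem_puncturedSphere_iff θ).1 hθ
    rw [h.K_symm.eq_of_height_eq (hPmem _ hx) (hPh _ hx).symm, hK0 _ hx]

theorem cylinderSolution (h : SphereSolution K f v) {b : OrthonormalBasis (Fin 3) ℝ E3}
    (hb : b 2 = (SphereEq.north : E3)) :
    CylinderSolution (toCylinder v b) (fun t φ => K (cylinderPoint b t φ))
      (fun t φ => f (cylinderPoint b t φ) / Real.cosh t ^ 2) where
  periodic t φ := by simp only [toCylinder, cylinderPoint_add_two_pi]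
  continuousOn := h.continuousOn_toCylinder hb
  hasLaplacianAt t φ hp := h.hasLaplacianAt_toCylinder hb hp
  K_nonneg t φ hp := h.K_nonneg _ ((cylinderPoint_mem_iff hb _ _).2 hp)
  F_nonneg t φ hp := div_nonneg (h.f_nonneg _ ((cylinderPoint_mem_iff hb _ _).2 hp)) (sq_nonneg _)
  K_mono t y φ h1 h2 hp := le_of_cylinder h.K_mono h.K_symm hb h1 h2 hp
  F_mono t y φ h1 h2 hp := by
    refine div_le_div₀ (h.f_nonneg _ ((cylinderPoint_mem_iff hb _ _).2 hp))
      (le_of_cylinder h.f_mono h.f_symm hb h1 h2 hp) (pow_pos (Real.cosh_pos y) 2)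
      (pow_le_pow_left₀ (Real.cosh_pos y).le (Real.cosh_le_cosh.2 ?_) 2)
    rw [abs_of_neg (by linarith : t < 0), abs_le]
    constructor <;> linarith
  coeff_le T hT := by
    obtain ⟨A, hA⟩ := (isCompact_endCaps b T).bddAbove_image
      (h.K_cont.mono (endCaps_subset hb hT.ne))
    obtain ⟨M, hM⟩ := (isCompact_endCaps b T).bddAbove_image
      (h.continuousOn.mono (endCaps_subset hb hT.ne))
    refine ⟨2 * |A| * Real.exp (2 * M) + 1, by positivity, fun t ht φ => ?_⟩
    have hmem : cylinderPoint b t φ ∈ endCaps b T := cylinderPoint_mem_endCaps b (by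
      rw [abs_of_neg hT, abs_of_neg (by linarith)]; linarith) φ
    have h1 : K (cylinderPoint b t φ) ≤ |A| :=
      (hA (Set.mem_image_of_mem _ hmem)).trans (le_abs_self A)
    have h2 : v (cylinderPoint b t φ) ≤ M := hM (Set.mem_image_of_mem _ hmem)
    have h3 : Real.exp (2 * v (cylinderPoint b t φ)) ≤ Real.exp (2 * M) :=
      Real.exp_le_exp.2 (by linarith)
    rw [exp_toCylinder, ← mul_div_assoc]
    refine div_le_div_of_nonneg_right ?_ (sq_nonneg _)
    have h4 : 2 * K (cylinderPoint b t φ) * Real.exp (2 * v (cylinderPoint b t φ)) ≤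
        2 * |A| * Real.exp (2 * M) :=
      mul_le_mul (by linarith) h3 (Real.exp_pos _).le (by positivity)
    linarith
  le_const := by
    obtain ⟨M, hM⟩ := (isCompact_endCaps b 1).bddAbove_image
      (h.continuousOn.mono (endCaps_subset hb one_ne_zero))
    refine ⟨M, fun t ht φ => ?_⟩
    have hmem : cylinderPoint b t φ ∈ endCaps b 1 := cylinderPoint_mem_endCaps b (by
      rw [abs_one, abs_of_neg (by linarith)]; linarith) φ
    have : v (cylinderPoint b t φ) ≤ M := hM (Set.mem_image_of_mem _ hmem)
    simpa [toCylinder] using this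
  const_le := by
    obtain ⟨m, hm⟩ := (isCompact_endCaps b 1).bddBelow_image
      (h.continuousOn.mono (endCaps_subset hb one_ne_zero))
    refine ⟨m, fun t φ ht => ?_⟩
    have hmem : cylinderPoint b t φ ∈ endCaps b 1 :=
      cylinderPoint_mem_endCaps b (by rwa [abs_one]) φ
    have : m ≤ v (cylinderPoint b t φ) := hm (Set.mem_image_of_mem _ hmem)
    simpa [toCylinder] using this
  log_le η hη := by
    obtain ⟨ρ, hρ, H⟩ := h.exists_log_le (half_pos hη)
    -- `poleFun < 1` gives `cosh² t < 2`, hence `2 log cosh t ≤ 1`. The last bound lets the spare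
    -- `(η / 2) log poleFun` absorb the resulting constant `(1 + η) / 2`.
    refine ⟨min ρ (min 1 (Real.exp (-(1 + η) / η))),
      lt_min hρ (lt_min one_pos (Real.exp_pos _)), fun t φ hp hlt => ?_⟩
    have hS := poleFun_pos hp
    have l1 := hlt.trans_le (min_le_left _ _)
    have l2 := hlt.trans_le ((min_le_right _ _).trans (min_le_left _ _))
    have l3 := hlt.trans_le ((min_le_right _ _).trans (min_le_right _ _))
    have hc2 : 0 < Real.cosh t ^ 2 := pow_pos (Real.cosh_pos t) 2
    have hc1 : 1 ≤ Real.cosh t ^ 2 := one_le_pow₀ (Real.one_le_cosh t)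
    have h1 := H _ ((cylinderPoint_mem_iff hb t φ).2 hp) (by
      rw [one_sub_height_cylinderPoint_sq hb]
      exact (div_le_self hS.le hc1).trans_lt l1)
    rw [one_sub_height_cylinderPoint_sq hb, Real.log_div hp hc2.ne', Real.log_pow] at h1
    have h2 : Real.log (poleFun t φ) ≤ -(1 + η) / η := by
      rw [← Real.log_exp (-(1 + η) / η)]
      exact Real.log_le_log hS l3.le
    rw [le_div_iff₀ hη] at h2
    have h3 : 2 * Real.log (Real.cosh t) ≤ 1 := by
      have e1 : Real.log (Real.cosh t ^ 2) = 2 * Real.log (Real.cosh t) := by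
        rw [Real.log_pow]; norm_num
      have e2 := Real.log_le_sub_one_of_pos hc2
      have e3 := Real.cosh_sq t
      have e4 : Real.sinh t ^ 2 ≤ poleFun t φ := by
        unfold poleFun; linarith [sq_nonneg (Real.sin φ)]
      linarith
    have h4 := mul_le_mul_of_nonneg_left h3 hη.le
    push_cast at h1
    rw [toCylinder]
    linarith
  uniform T hT ε hε := by
    have huc := (isCompact_endCaps b T).uniformContinuousOn_of_continuous
      (h.continuousOn.mono (endCaps_subset hb hT.ne))
    obtain ⟨δ, hδ, H⟩ := Metric.uniformContinuousOn_iff.1 huc (ε / 2) (half_pos hε)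
    -- The coordinate map is 2-Lipschitz in `t`, and `log cosh` is 1-Lipschitz.
    refine ⟨min (δ / 4) (ε / 2), lt_min (by linarith) (by linarith), fun t ht s hs0 hs φ => ?_⟩
    have hs1 := hs.trans (min_le_left _ _)
    have hs2 := hs.trans (min_le_right _ _)
    have hmem : ∀ r ≤ T, cylinderPoint b r φ ∈ endCaps b T := fun r hr =>
      cylinderPoint_mem_endCaps b (by rw [abs_of_neg hT, abs_of_neg (by linarith)]; linarith) φ
    have e : |t - s - t| = s := by
      rw [show t - s - t = -s by ring, abs_neg, abs_of_nonneg hs0]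
    have h1 := H _ (hmem (t - s) (by linarith)) _ (hmem t ht) (by
      have := dist_cylinderPoint_le b (t - s) t φ
      rw [e] at this
      linarith)
    have h2 := abs_sub_le_of_abs_deriv_le_one hasDerivAt_log_cosh
      (fun x => (Real.abs_tanh_lt_one x).le) (t - s) t
    rw [e] at h2
    rw [Real.dist_eq] at h1
    have h1' := abs_lt.1 h1
    have h2' := abs_le.1 h2
    rw [abs_le, toCylinder, toCylinder]
    constructor <;> linarith
  nondegenerate τ hτ := h.nondegenerate hb hτ

/-! ### Reflections -/

theorem exists_orthonormalBasis {e : E3} (he : ‖e‖ = 1)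
    (hen : inner ℝ e (SphereEq.north : E3) = (0 : ℝ)) :
    ∃ b : OrthonormalBasis (Fin 3) ℝ E3, b 0 = e ∧ b 2 = (SphereEq.north : E3) := by
  have hv : Orthonormal ℝ (Set.domRestrict ({0, 2} : Set (Fin 3)) ![e, 0, (SphereEq.north : E3)]) := by
    constructor
    · rintro ⟨i, rfl | rfl⟩
      · exact he
      · exact norm_north
    · rintro ⟨i, rfl | rfl⟩ ⟨j, rfl | rfl⟩ hij
      · exact absurd rfl hij
      · exact hen
      · exact (real_inner_comm _ _).trans hen
      · exact absurd rfl hij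
  obtain ⟨b, hb⟩ := hv.exists_orthonormalBasis_extension_of_card_eq (by simp)
  exact ⟨b, hb 0 (by simp), hb 2 (by simp)⟩

theorem exists_sin_cos {x y : ℝ} (h : x ^ 2 + y ^ 2 = 1) :
    ∃ φ, Real.sin φ = x ∧ Real.cos φ = y := by
  have hz : ‖(⟨y, x⟩ : ℂ)‖ = 1 := by
    have : ‖(⟨y, x⟩ : ℂ)‖ ^ 2 = 1 := by
      rw [Complex.sq_norm, Complex.normSq_mk]; linarith
    nlinarith [norm_nonneg (⟨y, x⟩ : ℂ)]
  have hz0 : (⟨y, x⟩ : ℂ) ≠ 0 := by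
    intro e
    rw [e, norm_zero] at hz
    norm_num at hz
  refine ⟨Complex.arg ⟨y, x⟩, ?_, ?_⟩
  · rw [Complex.sin_arg, hz, div_one]
  · rw [Complex.cos_arg hz0, hz, div_one]

/-- Cylindrical coordinates of a point of the sphere that is not on the axis. -/
theorem exists_cylinderMap_eq (b : OrthonormalBasis (Fin 3) ℝ E3) {θ : E3} (hθ : ‖θ‖ = 1)
    (h0 : 0 < inner ℝ (b 0) θ) (h1 : inner ℝ (b 0) θ < (1 : ℝ)) :
    ∃ t < 0, ∃ φ, cylinderMap b t φ = θ := by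
  have hsum := b.sum_repr' θ
  rw [Fin.sum_univ_three] at hsum
  have hnorm := b.sum_sq_norm_inner_right θ
  rw [Fin.sum_univ_three, hθ] at hnorm
  simp only [Real.norm_eq_abs, sq_abs] at hnorm
  set c := inner ℝ (b 0) θ with hc
  set x := inner ℝ (b 1) θ with hx
  set y := inner ℝ (b 2) θ with hy
  have hcI : c ∈ Set.Ioo (-1 : ℝ) 1 := ⟨by linarith, h1⟩
  have hs : 0 < Real.sqrt (1 - c ^ 2) := Real.sqrt_pos.2 (by nlinarith)
  have hs2 : Real.sqrt (1 - c ^ 2) ^ 2 = 1 - c ^ 2 := Real.sq_sqrt (by nlinarith)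
  obtain ⟨φ, hφ1, hφ2⟩ := exists_sin_cos
    (x := x / Real.sqrt (1 - c ^ 2)) (y := y / Real.sqrt (1 - c ^ 2)) (by
      rw [div_pow, div_pow, hs2, ← add_div, div_eq_one_iff_eq (by nlinarith)]
      linarith)
  refine ⟨-Real.artanh c, neg_lt_zero.2 (Real.artanh_pos ⟨h0, h1⟩), φ, ?_⟩
  rw [cylinderMap, Real.tanh_neg, neg_neg, Real.tanh_artanh hcI, Real.cosh_neg,
    Real.cosh_artanh hcI, hφ1, hφ2, ← hsum, smul_add, smul_smul, smul_smul, add_assoc]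
  congr 3 <;> field_simp

theorem cylinderMap_neg (b : OrthonormalBasis (Fin 3) ℝ E3) (t φ : ℝ) :
    cylinderMap b (-t) φ = cylinderMap b t φ - (2 * inner ℝ (b 0) (cylinderMap b t φ)) • b 0 := by
  have : inner ℝ (b 0) (cylinderMap b t φ) = -Real.tanh t := inner_zero_cylinderPoint b t φ
  rw [this]
  simp only [cylinderMap, Real.tanh_neg, Real.cosh_neg]
  module

/-- With `e` the normalised difference `θ - θ'`, orthogonal to the north pole by equality of
heights, `θ'` is the mirror image of `θ` in the plane orthogonal to `e`. The component of `θ` along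
`e` is `d / 2 > 0`, so `t < 0`; being non-antipodal gives `d / 2 < 1`, so `θ` is not an end of the
cylinder. -/
theorem le_of_height_eq_of_ne_neg (h : SphereSolution K f v) {θ θ' : S2}
    (hh : height θ' = height θ) (hne : (θ' : E3) ≠ -(θ : E3)) : v θ ≤ v θ' := by
  by_cases heq : θ' = θ
  · rw [heq]
  have hd : (θ : E3) - θ' ≠ 0 := fun e => heq (Subtype.ext (sub_eq_zero.1 e).symm)
  have hd0 : 0 < ‖(θ : E3) - θ'‖ := norm_pos_iff.2 hd
  set d := ‖(θ : E3) - θ'‖ with hdef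
  set e : E3 := d⁻¹ • ((θ : E3) - θ') with he
  have hen : ‖e‖ = 1 := by
    rw [he, norm_smul, norm_inv, norm_norm, ← hdef, inv_mul_cancel₀ hd0.ne']
  have hen' : inner ℝ e (SphereEq.north : E3) = (0 : ℝ) := by
    rw [he, inner_smul_left, inner_sub_left, real_inner_comm, ← height_eq_inner, real_inner_comm,
      ← height_eq_inner, hh]
    simp
  have hsub : (θ : E3) - θ' = d • e := by rw [he, smul_smul, mul_inv_cancel₀ hd0.ne', one_smul]
  have hθ1 : ‖(θ : E3)‖ = 1 := norm_eq_of_mem_sphere θ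
  have hθ'1 : ‖(θ' : E3)‖ = 1 := norm_eq_of_mem_sphere θ'
  have hd2 : d ^ 2 = 2 - 2 * inner ℝ (θ : E3) (θ' : E3) := by
    rw [hdef, @norm_sub_sq_real, hθ1, hθ'1]; ring
  have hinner : inner ℝ e (θ : E3) = d / 2 := by
    rw [he, inner_smul_left, inner_sub_left, real_inner_self_eq_norm_sq, hθ1,
      real_inner_comm (θ : E3) (θ' : E3)]
    simp
    field_simp
    linarith
  have hlt : d / 2 < 1 := by
    have h1 : 0 < ‖(θ' : E3) + θ‖ := norm_pos_iff.2 fun e0 => hne (eq_neg_of_add_eq_zero_left e0)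
    have h2 : ‖(θ' : E3) + θ‖ ^ 2 = 2 + 2 * inner ℝ (θ : E3) (θ' : E3) := by
      rw [@norm_add_sq_real, hθ1, hθ'1, real_inner_comm (θ : E3) (θ' : E3)]; ring
    nlinarith [pow_pos h1 2]
  obtain ⟨b, hb0, hb2⟩ := exists_orthonormalBasis hen hen'
  obtain ⟨t, ht, φ, hmap⟩ := exists_cylinderMap_eq b hθ1 (by rw [hb0, hinner]; linarith)
    (by rw [hb0, hinner]; exact hlt)
  have hp : cylinderPoint b t φ = θ := Subtype.ext hmap
  have hp' : cylinderPoint b (-t) φ = θ' := by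
    apply Subtype.ext
    show cylinderMap b (-t) φ = θ'
    rw [cylinderMap_neg, hmap, hb0, hinner, mul_div_cancel₀ d two_ne_zero, ← hsub, sub_sub_cancel]
  have := (h.cylinderSolution hb2).le_reflection ht φ
  rw [toCylinder, toCylinder, Real.cosh_neg, hp, hp'] at this
  linarith

/-- Antipodal points of equal height lie on the equator; an equatorial point orthogonal to both
links them. -/
theorem le_of_height_eq (h : SphereSolution K f v) {θ θ' : S2} (hh : height θ' = height θ) :
    v θ ≤ v θ' := by
  by_cases hne : (θ' : E3) = -(θ : E3)
  · have hθ0 : height θ = 0 := by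
      have : height θ' = -height θ := by rw [height_eq_inner, hne, inner_neg_right, height_eq_inner]
      linarith
    obtain ⟨b, hb0, hb2⟩ := exists_orthonormalBasis (e := (θ : E3)) (norm_eq_of_mem_sphere θ)
      (by rw [real_inner_comm, ← height_eq_inner, hθ0])
    set σ : S2 := ⟨b 1, by simp⟩ with hσ
    have hσh : height σ = 0 := by
      rw [height_eq_inner, ← hb2]
      show inner ℝ (b 2) (b 1) = (0 : ℝ)
      simp [b.inner_eq_ite]
    have h1 : (σ : E3) ≠ -(θ : E3) := by
      intro e
      have h3 : inner ℝ (b 1) (b 1) = (0 : ℝ) := by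
        nth_rewrite 2 [show b 1 = -b 0 by rw [hb0]; exact e]
        simp [b.inner_eq_ite]
      simp at h3
    have h2 : (θ' : E3) ≠ -(σ : E3) := by
      rw [hne]
      intro e
      have h3 : inner ℝ (b 1) (b 1) = (0 : ℝ) := by
        nth_rewrite 2 [show b 1 = b 0 by rw [hb0]; exact (neg_injective e).symm]
        simp [b.inner_eq_ite]
      simp at h3
    exact (h.le_of_height_eq_of_ne_neg (by rw [hσh, hθ0]) h1).trans
      (h.le_of_height_eq_of_ne_neg (by rw [hσh, hh, hθ0]) h2)
  · exact h.le_of_height_eq_of_ne_neg hh hne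

theorem rotSymm (h : SphereSolution K f v) : RotSymm v :=
  rotSymm_of_height fun _ _ _ _ hh => h.le_of_height_eq hh

end SphereSolution

end SphereEq

end

theorem theorem1p6 (K f v : SphereEq.S2 → ℝ)
    (hK_cont : ContinuousOn K SphereEq.puncturedSphere)
    (hf_cont : ContinuousOn f SphereEq.puncturedSphere)
    (hK_nonneg : ∀ θ ∈ SphereEq.puncturedSphere, 0 ≤ K θ)
    (hf_nonneg : ∀ θ ∈ SphereEq.puncturedSphere, 0 ≤ f θ)
    (hK_mono : SphereEq.MonotoneTowardsPoles K)
    (hf_mono : SphereEq.MonotoneTowardsPoles f)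
    (hKf : ∃ θ ∈ SphereEq.puncturedSphere,
      (f θ) ^ 2 + (K θ - ⨍ σ, K σ ∂SphereEq.surfaceMeasure) ^ 2 ≠ 0)
    (hK_symm : SphereEq.RotSymm K)
    (hf_symm : SphereEq.RotSymm f)
    (hv : ContMDiffOn (𝓡 2) 𝓘(ℝ, ℝ) 2 v SphereEq.puncturedSphere)
    (hv_eq : ∀ θ ∈ SphereEq.puncturedSphere,
      -SphereEq.sphereLaplacian v θ + 1 = K θ * Real.exp (2 * v θ) + f θ)
    (hv_north : limsup (fun θ : SphereEq.S2 =>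
        ((v θ / Real.log (SphereEq.geodDist θ SphereEq.north) : ℝ) : EReal))
      (𝓝[≠] SphereEq.north) ≤ 0)
    (hv_south : limsup (fun θ : SphereEq.S2 =>
        ((v θ / Real.log (SphereEq.geodDist θ SphereEq.south) : ℝ) : EReal))
      (𝓝[≠] SphereEq.south) ≤ 0) :
    SphereEq.RotSymm v :=
  SphereEq.SphereSolution.rotSymm
    { K_cont := hK_cont, K_nonneg := hK_nonneg, f_nonneg := hf_nonneg, K_mono := hK_mono,
      f_mono := hf_mono, nontrivial := hKf, K_symm := hK_symm, f_symm := hf_symm,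
      contMDiffOn := hv, equation := hv_eq, north := hv_north, south := hv_south }
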